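/- Let $|0\rangle,\dots,|3\rangle$ be the standard basis of $\mathbb{C}^4$ and, for $j,k\in\{1,\dots,4\}$, let $$D_{jk}=e^{\pi i jk/4}\sum_{m=0}^{3} i^{\,jm}\,|k\oplus m\rangle\langle m| ,$$ where $\oplus$ is addition modulo $4$. A SIC-POVM in $\mathbb{C}^4$ is a set of $16$ normalized vectors with $|\langle\phi|\psi\rangle|^2=1/5$ for any two distinct members; its POVM elements are the operators $|\phi\rangle\langle\phi|/4$. A normalized vector $|\phi\rangle\in\mathbb{C}^4$ is called a fiducial vector if $\{D_{jk}|\phi\rangle\}_{j,k=1}^{4}$ is a SIC-POVM. Let $$r_0=\frac{\sqrt{1-1/\sqrt5}}{2\sqrt{2-\sqrt2}},\qquad r_1=(\sqrt2-1)\,r_0,\qquad r_\pm=\tfrac12\sqrt{1+1/\sqrt5\pm\sqrt{1/5+1/\sqrt5}},$$ $$a=\arccos\frac{2}{\sqrt{5+\sqrt5}},\qquad b=\arcsin\frac{2}{\sqrt5},$$ and let $\Omega\subset\mathbb{R}^3$ be the set of all triples $$\Big((-1)^m\big(\tfrac a2+\tfrac b4\big)+\tfrac{\pi(m+2n+7j+1)}4,\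 \ \tfrac{\pi(2k+1)}2,\ \ (-1)^m\big(-\tfrac a2+\tfrac b4\big)+\tfrac{\pi(m+2n+3j+4k+1)}4\Big)$$ with $j,k,m\in\{0,1\}$ and $n\in\{0,1,2,3\}$. Let $F$ be the set of all vectors $$\big(r_0,\ r_+e^{i\theta_+},\ r_1e^{i\theta_1},\ r_-e^{i\theta_-}\big)^T\quad\text{and}\quad \big(r_0,\ r_-e^{i\theta_-},\ r_1e^{i\theta_1},\ r_+e^{i\theta_+}\big)^T,\qquad(\theta_+,\theta_1,\theta_-)\in\Omega,$$ together with all vectors obtained from these by cyclic shifts of the entries. Then $F$ is, up to global phases, the complete set of fiducial vectors: $|\phi\rangle\in\mathbb{C}^4$ is a fiducial vector if and only if $|\phi\rangle=z|v\rangle$ for some $|v\rangle\in F$ and some $z\in\mathbb{C}$ with $|z|=1$. Moreover, exactly $16$ distinct SIC-POVMs arise as orbits $\{D_{jk}|\phi\rangle\}$ of fiducial vectors, where two SIC-POVMs are identified if they have the same set of POVM elements. -/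

import Mathlib

/-! Weyl–Heisenberg covariant SIC-POVMs, and the explicit vectors in dimension four. -/

/-- The displacement operator `D_{jk} = ω^{jk/2} ∑_m ω^{jm} |k ⊕ m⟩⟨m|`, with `ω = exp(2πi/d)`,
`ω^{1/2} = exp(πi/d)` and `⊕` addition modulo `d`, as a matrix in the standard basis. -/
noncomputable def displacement (d j k : ℕ) : Matrix (Fin d) (Fin d) ℂ :=
  Matrix.of fun a m =>
    if (a : ℕ) = (k + (m : ℕ)) % d then
      Complex.exp (Real.pi * Complex.I / d) ^ (j * k) *
        Complex.exp (2 * Real.pi * Complex.I / d) ^ (j * (m : ℕ))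
    else 0

/-- A SIC-POVM in `ℂ^d`, given by its vectors: a set of `d ^ 2` normalized vectors
whose pairwise overlaps `|⟨φ, ψ⟩|²` are all equal to `1 / (d + 1)`. -/
structure IsSICPOVM (d : ℕ) (P : Set (EuclideanSpace ℂ (Fin d))) : Prop where
  card_eq : P.ncard = d ^ 2
  norm_eq_one : ∀ φ ∈ P, ‖φ‖ = 1
  overlap_eq : ∀ φ ∈ P, ∀ ψ ∈ P, φ ≠ ψ → ‖inner ℂ φ ψ‖ ^ 2 = 1 / ((d : ℝ) + 1)

/-- The set `{D_{jk} φ}`, `j, k = 1, …, d`. -/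
def displacementOrbit (d : ℕ) (φ : EuclideanSpace ℂ (Fin d)) :
    Set (EuclideanSpace ℂ (Fin d)) :=
  {ψ | ∃ j ∈ Set.Icc 1 d, ∃ k ∈ Set.Icc 1 d,
    ψ = Matrix.toEuclideanLin (displacement d j k) φ}

/-- A fiducial vector: a normalized vector whose orbit is a SIC-POVM. -/
def IsFiducial (d : ℕ) (φ : EuclideanSpace ℂ (Fin d)) : Prop :=
  ‖φ‖ = 1 ∧ IsSICPOVM d (displacementOrbit d φ)

/-- The POVM elements `|φ⟩⟨φ| / d`, `φ ∈ P`, of a set `P` of normalized vectors. Two sets of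
vectors that differ by phases only have the same POVM elements. -/
def povmElements (d : ℕ) (P : Set (EuclideanSpace ℂ (Fin d))) :
    Set (Matrix (Fin d) (Fin d) ℂ) :=
  {E | ∃ φ ∈ P, E = (1 / (d : ℂ)) • Matrix.vecMulVec φ.ofLp (star φ.ofLp)}

/-- The SIC-POVMs generated by the operators `D_{jk}`, each one as its set of POVM elements. -/
def covariantSICPOVMs (d : ℕ) : Set (Set (Matrix (Fin d) (Fin d) ℂ)) :=
  {S | ∃ φ, IsFiducial d φ ∧ S = povmElements d (displacementOrbit d φ)}

namespace DimFour

noncomputable def r0 : ℝ := √(1 - 1 / √5) / (2 * √(2 - √2))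

noncomputable def r1 : ℝ := (√2 - 1) * r0

noncomputable def rPlus : ℝ := 1 / 2 * √(1 + 1 / √5 + √(1 / 5 + 1 / √5))

noncomputable def rMinus : ℝ := 1 / 2 * √(1 + 1 / √5 - √(1 / 5 + 1 / √5))

noncomputable def a : ℝ := Real.arccos (2 / √(5 + √5))

noncomputable def b : ℝ := Real.arcsin (2 / √5)

/-- The set of phase triples `(θ₊, θ₁, θ₋)`. -/
def Omega : Set (ℝ × ℝ × ℝ) :=
  {θ | ∃ j k m n : ℕ, j < 2 ∧ k < 2 ∧ m < 2 ∧ n < 4 ∧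
    θ = ((-1) ^ m * (a / 2 + b / 4) + Real.pi * (m + 2 * n + 7 * j + 1) / 4,
      Real.pi * (2 * k + 1) / 2,
      (-1) ^ m * (-a / 2 + b / 4) + Real.pi * (m + 2 * n + 3 * j + 4 * k + 1) / 4)}

/-- The complex number `r e^{iθ}`. -/
noncomputable def polar (r θ : ℝ) : ℂ := r * Complex.exp (θ * Complex.I)

/-- Cyclic shift of the entries of a vector by `c` places. -/
def cycle (c : Fin 4) (v : EuclideanSpace ℂ (Fin 4)) : EuclideanSpace ℂ (Fin 4) :=
  WithLp.toLp 2 fun i => v (i + c)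

/-- The explicit vectors, for all phase triples, together with all their cyclic shifts. -/
def fiducialVectors : Set (EuclideanSpace ℂ (Fin 4)) :=
  {v | ∃ θp θ1 θm : ℝ, (θp, θ1, θm) ∈ Omega ∧ ∃ c : Fin 4,
    v = cycle c !₂[(r0 : ℂ), polar rPlus θp, polar r1 θ1, polar rMinus θm] ∨
    v = cycle c !₂[(r0 : ℂ), polar rMinus θm, polar r1 θ1, polar rPlus θp]}

end DimFour

/-! Up to phases the operators $D_{jk}$ form a group, so the SIC condition only concerns the
overlaps of $\phi$ with its own translates (`isFiducial_iff_overlap`). For a fixed shift $k$ these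
overlaps are the discrete Fourier transform in $j$ of $a\mapsto x_{a-k}\bar x_a$. A transform is
flat exactly when the cyclic autocorrelation is a delta function (`fourier_flat`), which turns the
condition into the seven polynomial equations of `Sol` (`isFiducial_iff_sol`).

One of them is $\mathrm{Re}(x_0\bar x_2)\,\mathrm{Re}(x_1\bar x_3)=0$. After a cyclic shift,
$x_0\bar x_2$ is imaginary and $|x_0|\ge|x_2|$. Taking the modulus of the `phase` equation then
leaves equations in the $|x_i|^2$ alone, whose solution is $r_0,r_1,r_\pm$ (`Sol.moduli`).

With $x_0$ made positive, let $u,v,w$ be the phases of the other entries, $u$ belonging to $r_+$ and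
$w$ to $r_-$. The rest of the system says that $v=\pm i$, that $\mathrm{Re}((u\bar w)^2)=\cos 2a$,
so $u\bar w=\pm e^{\pm ia}$, and that $(uw)^2$ is a prescribed number, computed by `phase_identity`.
Hence $u^4$ is known, $u$ is fixed up to a power of $i$, and $w$ follows (`PhaseEq.exists_cis`).
This is the set $\Omega$.

For the count, cyclic shifts and changes of $n$ are themselves displacements (the latter also moving
$k$), so each orbit has a representative with $n=0$ and no shift: $2\cdot2^3=16$ labels. Distinct
labels give distinct SIC-POVMs (`sic_injective`), because $r_0$ is the modulus of one entry only and
`phases_inj` recovers the signs. -/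

open Complex ComplexConjugate

namespace DimFour

/-! ### Displacement operators modulo phases -/

/-- The displacement operators in dimension four, without the prefactor. -/
noncomputable def weyl (j k : Fin 4) (x : EuclideanSpace ℂ (Fin 4)) : EuclideanSpace ℂ (Fin 4) :=
  WithLp.toLp 2 fun a => I ^ ((j : ℕ) * (a : ℕ)) * x (a - k)

lemma exp_two_pi_div_four : Complex.exp (2 * Real.pi * I / (4 : ℕ)) = I := by
  rw [show 2 * (Real.pi : ℂ) * I / (4 : ℕ) = Real.pi / 2 * I by push_cast; ring]
  exact Complex.exp_pi_div_two_mul_I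

lemma norm_exp_pi_div_four : ‖Complex.exp (Real.pi * I / (4 : ℕ))‖ = 1 := by
  rw [show (Real.pi : ℂ) * I / (4 : ℕ) = ((Real.pi / 4 : ℝ) : ℂ) * I by push_cast; ring]
  exact Complex.norm_exp_ofReal_mul_I _

lemma I_pow_mod (n : ℕ) : I ^ n = I ^ (n % 4) := by
  conv_lhs => rw [← Nat.div_add_mod n 4, pow_add, pow_mul, I_pow_four, one_pow, one_mul]

lemma I_pow_congr {m n : ℕ} (h : m % 4 = n % 4) : I ^ m = I ^ n := by
  rw [I_pow_mod m, I_pow_mod n, h]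

lemma norm_I_pow (n : ℕ) : ‖I ^ n‖ = 1 := by simp

lemma displacement_apply (j k : ℕ) (x : EuclideanSpace ℂ (Fin 4)) :
    Matrix.toEuclideanLin (displacement 4 j k) x =
      (Complex.exp (Real.pi * I / (4 : ℕ)) ^ (j * k) * I ^ (3 * (j * k))) •
        weyl (Fin.ofNat 4 j) (Fin.ofNat 4 k) x := by
  ext a
  have hsum : (Matrix.toEuclideanLin (displacement 4 j k) x) a =
      ∑ m, displacement 4 j k a m * x m := rfl
  rw [hsum, Finset.sum_eq_single (a - Fin.ofNat 4 k)]
  · have h1 : (a : ℕ) = (k + ((a - Fin.ofNat 4 k : Fin 4) : ℕ)) % 4 := by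
      rw [Fin.val_sub, Fin.val_ofNat]
      omega
    -- Here $i^{j(a-k)}=i^{-jk}i^{ja}$, with $-1$ replaced by $3$ modulo $4$ to keep exponents
    -- natural.
    have h2 : I ^ (j * ((a - Fin.ofNat 4 k : Fin 4) : ℕ)) =
        I ^ (3 * (j * k)) * I ^ (((Fin.ofNat 4 j : Fin 4) : ℕ) * (a : ℕ)) := by
      rw [← pow_add]
      apply I_pow_congr
      rw [Fin.val_ofNat, Fin.val_sub, Fin.val_ofNat]
      change _ ≡ _ [MOD 4]
      have e1 : (4 - k % 4 + (a : ℕ)) % 4 ≡ 3 * k + a [MOD 4] := by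
        change _ % 4 = _ % 4
        omega
      calc _ ≡ j * (3 * k + a) [MOD 4] := e1.mul_left _
        _ = 3 * (j * k) + j * a := by ring
        _ ≡ 3 * (j * k) + j % 4 * a [MOD 4] :=
          Nat.ModEq.add_left _ ((Nat.mod_modEq j 4).symm.mul_right _)
    simp only [displacement, Matrix.of_apply, if_pos h1, exp_two_pi_div_four, h2, weyl,
      PiLp.smul_apply, smul_eq_mul]
    ring
  · intro m _ hm
    have : ¬ ((a : ℕ) = (k + (m : ℕ)) % 4) := by
      intro h
      apply hm
      apply Fin.ext
      rw [Fin.val_sub, Fin.val_ofNat]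
      omega
    simp [displacement, this]
  · simp

lemma exists_phase_displacement (j k : ℕ) (x : EuclideanSpace ℂ (Fin 4)) :
    ∃ z : ℂ, ‖z‖ = 1 ∧ Matrix.toEuclideanLin (displacement 4 j k) x =
      z • weyl (Fin.ofNat 4 j) (Fin.ofNat 4 k) x := by
  refine ⟨_, ?_, displacement_apply j k x⟩
  rw [norm_mul, norm_pow, norm_exp_pi_div_four, norm_I_pow, one_pow, one_mul]

lemma displacement_four (x : EuclideanSpace ℂ (Fin 4)) :
    Matrix.toEuclideanLin (displacement 4 4 4) x = x := by
  rw [displacement_apply]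
  have h : Complex.exp (Real.pi * I / (4 : ℕ)) ^ (4 * 4) * I ^ (3 * (4 * 4)) = 1 := by
    rw [← Complex.exp_nat_mul, I_pow_mod]
    rw [show ((4 * 4 : ℕ) : ℂ) * (Real.pi * I / (4 : ℕ)) = 2 * Real.pi * I + 2 * Real.pi * I by
      push_cast; ring, Complex.exp_add, Complex.exp_two_pi_mul_I]
    norm_num
  rw [h, one_smul]
  ext a
  simp [weyl]

lemma weyl_smul (j k : Fin 4) (z : ℂ) (x : EuclideanSpace ℂ (Fin 4)) :
    weyl j k (z • x) = z • weyl j k x := by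
  ext a
  simp [weyl]
  ring

lemma inner_weyl_weyl (j k : Fin 4) (x y : EuclideanSpace ℂ (Fin 4)) :
    inner ℂ (weyl j k x) (weyl j k y) = inner ℂ x y := by
  rw [PiLp.inner_apply, PiLp.inner_apply,
    ← Equiv.sum_comp (Equiv.subRight k) (fun a => inner ℂ (x a) (y a))]
  refine Finset.sum_congr rfl fun a _ => ?_
  have h : ∀ n : ℕ, I ^ n * conj (I ^ n) = 1 := by
    intro n
    rw [Complex.mul_conj, Complex.normSq_eq_norm_sq, norm_I_pow]
    simp
  simp only [weyl, RCLike.inner_apply, map_mul, Equiv.subRight_apply]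
  linear_combination (y (a - k) * conj (x (a - k))) * h ((j : ℕ) * (a : ℕ))

lemma weyl_comp (j k j' k' : Fin 4) (x : EuclideanSpace ℂ (Fin 4)) :
    weyl j k (weyl j' k' x) = I ^ (3 * ((j' : ℕ) * (k : ℕ))) • weyl (j + j') (k + k') x := by
  ext a
  have h : I ^ ((j : ℕ) * (a : ℕ)) * I ^ ((j' : ℕ) * ((a - k : Fin 4) : ℕ)) =
      I ^ (3 * ((j' : ℕ) * (k : ℕ))) * I ^ (((j + j' : Fin 4) : ℕ) * (a : ℕ)) := by
    rw [← pow_add, ← pow_add]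
    apply I_pow_congr
    revert j k j' a
    decide
  simp only [weyl, PiLp.smul_apply, smul_eq_mul, sub_sub]
  linear_combination (x (a - (k + k'))) * h

/-- Unitarity and the composition law up to phase make an overlap depend on the difference of the
indices only. -/
lemma norm_inner_weyl_weyl (j k j' k' : Fin 4) (x y : EuclideanSpace ℂ (Fin 4)) :
    ‖inner ℂ (weyl j k x) (weyl j' k' y)‖ = ‖inner ℂ x (weyl (j' - j) (k' - k) y)‖ := by
  have h := weyl_comp j k (j' - j) (k' - k) y
  rw [add_sub_cancel, add_sub_cancel] at h
  rw [← inner_weyl_weyl j k x, h, inner_smul_right, norm_mul, norm_I_pow, one_mul]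

lemma weyl_zero (x : EuclideanSpace ℂ (Fin 4)) : weyl 0 0 x = x := by
  ext a
  simp [weyl]

lemma norm_weyl (j k : Fin 4) (x : EuclideanSpace ℂ (Fin 4)) : ‖weyl j k x‖ = ‖x‖ := by
  have h := inner_weyl_weyl j k x x
  rw [inner_self_eq_norm_sq_to_K, inner_self_eq_norm_sq_to_K] at h
  have h' : ‖weyl j k x‖ ^ 2 = ‖x‖ ^ 2 := by exact_mod_cast h
  exact (sq_eq_sq₀ (norm_nonneg _) (norm_nonneg _)).1 h'

/-! ### Fiducial vectors through overlaps with their translates -/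

lemma exists_lift (j : Fin 4) : ∃ n ∈ Finset.Icc 1 4, Fin.ofNat 4 n = j := by
  revert j
  decide

lemma ofNat_inj {m n : ℕ} (hm : m ∈ Finset.Icc 1 4) (hn : n ∈ Finset.Icc 1 4)
    (h : Fin.ofNat 4 m = Fin.ofNat 4 n) : m = n := by
  rw [Finset.mem_Icc] at hm hn
  have := congrArg Fin.val h
  simp only [Fin.val_ofNat] at this
  omega

lemma displacementOrbit_eq_image (φ : EuclideanSpace ℂ (Fin 4)) :
    displacementOrbit 4 φ = (fun p : ℕ × ℕ => Matrix.toEuclideanLin (displacement 4 p.1 p.2) φ) ''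
      (Finset.Icc 1 4 ×ˢ Finset.Icc 1 4 : Finset (ℕ × ℕ)) := by
  ext ψ
  constructor
  · rintro ⟨j, hj, k, hk, rfl⟩
    exact ⟨(j, k), Finset.mem_coe.2 (Finset.mem_product.2
      ⟨Finset.mem_Icc.2 hj, Finset.mem_Icc.2 hk⟩), rfl⟩
  · rintro ⟨⟨j, k⟩, h, rfl⟩
    have h' := Finset.mem_product.1 (Finset.mem_coe.1 h)
    exact ⟨j, Finset.mem_Icc.1 h'.1, k, Finset.mem_Icc.1 h'.2, rfl⟩

theorem isFiducial_iff_overlap (φ : EuclideanSpace ℂ (Fin 4)) :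
    IsFiducial 4 φ ↔ ‖φ‖ = 1 ∧ ∀ j k : Fin 4, (j, k) ≠ (0, 0) →
      ‖inner ℂ φ (weyl j k φ)‖ ^ 2 = 1 / 5 := by
  have h5 : (1 : ℝ) / (((4 : ℕ) : ℝ) + 1) = 1 / 5 := by norm_num
  set D : ℕ × ℕ → EuclideanSpace ℂ (Fin 4) :=
    fun p => Matrix.toEuclideanLin (displacement 4 p.1 p.2) φ with hD
  set T : Finset (ℕ × ℕ) := Finset.Icc 1 4 ×ˢ Finset.Icc 1 4 with hT
  have hTc : T.card = 16 := by rw [hT]; decide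
  unfold IsFiducial
  refine and_congr_right fun hφ => ⟨fun h j k hjk => ?_, fun h => ?_⟩
  -- The orbit is a set, so `overlap_eq` is silent on coinciding vectors. Its cardinality $16$ rules
  -- out coincidences.
  · have hinj : Set.InjOn D T := by
      apply Set.injOn_of_ncard_image_eq _ T.finite_toSet
      rw [← displacementOrbit_eq_image, h.card_eq, Set.ncard_coe_finset, hTc]
      norm_num
    obtain ⟨m, hm, rfl⟩ := exists_lift j
    obtain ⟨n, hn, rfl⟩ := exists_lift k
    have hmn : (m, n) ∈ T := Finset.mem_product.2 ⟨hm, hn⟩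
    -- Indices run from $1$ to $4$, so $(4,4)$ plays the role of $(0,0)$: $D_{44}$ is the identity.
    have h44 : (4, 4) ∈ T := by rw [hT]; decide
    have hne : (4, 4) ≠ (m, n) := by
      rintro he
      obtain ⟨rfl, rfl⟩ := Prod.mk.inj he
      exact hjk rfl
    have hmem : ∀ p ∈ T, D p ∈ displacementOrbit 4 φ := fun p hp => by
      rw [displacementOrbit_eq_image]
      exact ⟨p, hp, rfl⟩
    have := h.overlap_eq _ (hmem _ h44) _ (hmem _ hmn) (fun he => hne (hinj h44 hmn he))
    rw [h5] at this
    obtain ⟨z, hz, hz'⟩ := exists_phase_displacement m n φ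
    have e1 : D (4, 4) = φ := displacement_four φ
    have e2 : D (m, n) = z • weyl (Fin.ofNat 4 m) (Fin.ofNat 4 n) φ := hz'
    rwa [e1, e2, inner_smul_right, norm_mul, hz, one_mul] at this
  · have hov : ∀ p ∈ T, ∀ q ∈ T, p ≠ q → ‖inner ℂ (D p) (D q)‖ ^ 2 = 1 / 5 := by
      rintro ⟨j, k⟩ hp ⟨j', k'⟩ hq hpq
      obtain ⟨z, hz, hz'⟩ := exists_phase_displacement j k φ
      obtain ⟨w, hw, hw'⟩ := exists_phase_displacement j' k' φ
      simp only [hD]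
      rw [hz', hw', inner_smul_left, inner_smul_right, norm_mul, norm_mul, RCLike.norm_conj,
        hz, hw, one_mul, one_mul, norm_inner_weyl_weyl]
      apply h
      intro he
      obtain ⟨h1, h2⟩ := Prod.mk.inj he
      rw [sub_eq_zero] at h1 h2
      rw [hT, Finset.mem_product] at hp hq
      exact hpq (Prod.ext (ofNat_inj hq.1 hp.1 h1).symm (ofNat_inj hq.2 hp.2 h2).symm)
    have hnorm : ∀ p, ‖D p‖ = 1 := by
      rintro ⟨j, k⟩
      obtain ⟨z, hz, hz'⟩ := exists_phase_displacement j k φ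
      simp only [hD]
      rw [hz', norm_smul, hz, norm_weyl, hφ, one_mul]
    -- Coinciding unit vectors would have overlap $1\ne1/5$.
    have hinj : Set.InjOn D T := by
      intro p hp q hq hpq
      by_contra hne
      have := hov p hp q hq hne
      rw [hpq, inner_self_eq_norm_sq_to_K, hnorm] at this
      norm_num at this
    refine ⟨?_, ?_, ?_⟩
    · rw [displacementOrbit_eq_image, hinj.ncard_image, Set.ncard_coe_finset, hTc]
      norm_num
    · rw [displacementOrbit_eq_image]
      rintro _ ⟨p, _, rfl⟩
      exact hnorm p
    · rw [displacementOrbit_eq_image, h5]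
      rintro _ ⟨p, hp, rfl⟩ _ ⟨q, hq, rfl⟩ hne
      exact hov p hp q hq (fun he => hne (by rw [he]))

/-! ### Reduction to polynomial equations by Fourier analysis -/

/-- The polynomial equations for a fiducial vector with the entries `x₀, x₁, x₂, x₃`. -/
structure Sol (x₀ x₁ x₂ x₃ : ℂ) : Prop where
  sum_eq : normSq x₀ + normSq x₁ + normSq x₂ + normSq x₃ = 1
  sum_sq : normSq x₀ ^ 2 + normSq x₁ ^ 2 + normSq x₂ ^ 2 + normSq x₃ ^ 2 = 2 / 5
  cross : (normSq x₀ + normSq x₂) * (normSq x₁ + normSq x₃) = 1 / 5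
  diag : normSq x₀ * normSq x₂ + normSq x₁ * normSq x₃ = 1 / 10
  re_mul : (x₀ * conj x₂).re * (x₁ * conj x₃).re = 0
  re_sq : ((x₀ * conj x₂) ^ 2 + (x₁ * conj x₃) ^ 2).re = 0
  phase : x₀ * x₂ * (conj x₁ ^ 2 + conj x₃ ^ 2) + x₁ * x₃ * (conj x₀ ^ 2 + conj x₂ ^ 2) = 0

/-- The cyclic autocorrelation of four numbers is `c` times the delta function. -/
def Uncorrelated (c : ℝ) (y₀ y₁ y₂ y₃ : ℂ) : Prop :=
  normSq y₀ + normSq y₁ + normSq y₂ + normSq y₃ = c ∧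
    (y₂ * conj y₀ + y₃ * conj y₁).re = 0 ∧
    y₁ * conj y₀ + y₂ * conj y₁ + y₃ * conj y₂ + y₀ * conj y₃ = 0

/-- Four numbers have a flat discrete Fourier transform if and only if their cyclic
autocorrelation vanishes. -/
lemma fourier_flat (y₀ y₁ y₂ y₃ : ℂ) (c : ℝ) :
    (normSq (y₀ + y₁ + y₂ + y₃) = c ∧ normSq (y₀ + I * y₁ - y₂ - I * y₃) = c ∧
      normSq (y₀ - y₁ + y₂ - y₃) = c ∧ normSq (y₀ - I * y₁ - y₂ + I * y₃) = c) ↔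
    Uncorrelated c y₀ y₁ y₂ y₃ := by
  change _ ↔ (normSq y₀ + normSq y₁ + normSq y₂ + normSq y₃ = c ∧
      (y₂ * conj y₀ + y₃ * conj y₁).re = 0 ∧
      y₁ * conj y₀ + y₂ * conj y₁ + y₃ * conj y₂ + y₀ * conj y₃ = 0)
  rw [Complex.ext_iff (z := y₁ * conj y₀ + y₂ * conj y₁ + y₃ * conj y₂ + y₀ * conj y₃)]
  simp only [normSq_apply, add_re, add_im, sub_re, sub_im, mul_re, mul_im, I_re, I_im, conj_re,
    conj_im, zero_re, zero_im]
  -- The autocorrelation at lag $2$ is twice the real part in `Uncorrelated`, and lag $3$ is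
  -- conjugate to lag $1$. Both sides are thus four real equations, linked by an invertible linear
  -- map.
  constructor
  · rintro ⟨h0, h1, h2, h3⟩
    refine ⟨?_, ?_, ?_, ?_⟩
    · linear_combination (h0 + h1 + h2 + h3) / 4
    · linear_combination (h0 - h1 + h2 - h3) / 8
    · linear_combination (h0 - h2) / 4
    · linear_combination (h3 - h1) / 4
  · rintro ⟨h0, h1, h2, h3⟩
    refine ⟨?_, ?_, ?_, ?_⟩
    · linear_combination h0 + 2 * h1 + 2 * h2
    · linear_combination h0 - 2 * h1 - 2 * h3
    · linear_combination h0 + 2 * h1 - 2 * h2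
    · linear_combination h0 - 2 * h1 + 2 * h3

lemma inner_weyl_eq (j k : Fin 4) (x : EuclideanSpace ℂ (Fin 4)) :
    inner ℂ x (weyl j k x) =
      x (0 - k) * conj (x 0) + I ^ (j : ℕ) * (x (1 - k) * conj (x 1)) +
        I ^ ((j : ℕ) * 2) * (x (2 - k) * conj (x 2)) +
        I ^ ((j : ℕ) * 3) * (x (3 - k) * conj (x 3)) := by
  rw [PiLp.inner_apply, Fin.sum_univ_four]
  simp only [RCLike.inner_apply, weyl, Fin.val_zero, mul_zero, pow_zero, one_mul, Fin.val_one,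
    mul_one, mul_assoc]
  rfl

lemma norm_sq_inner_weyl (k : Fin 4) (x : EuclideanSpace ℂ (Fin 4)) (y₀ y₁ y₂ y₃ : ℂ)
    (h₀ : x (0 - k) * conj (x 0 : ℂ) = y₀) (h₁ : x (1 - k) * conj (x 1 : ℂ) = y₁)
    (h₂ : x (2 - k) * conj (x 2 : ℂ) = y₂) (h₃ : x (3 - k) * conj (x 3 : ℂ) = y₃) :
    ‖inner ℂ x (weyl 0 k x)‖ ^ 2 = normSq (y₀ + y₁ + y₂ + y₃) ∧
    ‖inner ℂ x (weyl 1 k x)‖ ^ 2 = normSq (y₀ + I * y₁ - y₂ - I * y₃) ∧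
    ‖inner ℂ x (weyl 2 k x)‖ ^ 2 = normSq (y₀ - y₁ + y₂ - y₃) ∧
    ‖inner ℂ x (weyl 3 k x)‖ ^ 2 = normSq (y₀ - I * y₁ - y₂ + I * y₃) := by
  have e2 : I ^ 2 = -1 := I_sq
  have e3 : I ^ 3 = -I := I_pow_three
  have e4 : I ^ 4 = 1 := I_pow_four
  have e6 : I ^ 6 = -1 := by rw [I_pow_mod]; exact I_sq
  have e9 : I ^ 9 = I := by rw [I_pow_mod]; norm_num
  have v2 : ((2 : Fin 4) : ℕ) = 2 := rfl
  have v3 : ((3 : Fin 4) : ℕ) = 3 := rfl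
  refine ⟨?_, ?_, ?_, ?_⟩ <;>
    rw [inner_weyl_eq, h₀, h₁, h₂, h₃, Complex.normSq_eq_norm_sq] <;>
    simp only [Fin.val_zero, Fin.val_one, v2, v3, zero_mul, pow_zero, one_mul, pow_one,
      Nat.reduceMul, e2, e3, e4, e6, e9] <;>
    congr 2 <;> ring

lemma norm_eq_one_iff (x : EuclideanSpace ℂ (Fin 4)) :
    ‖x‖ = 1 ↔ normSq (x 0) + normSq (x 1) + normSq (x 2) + normSq (x 3) = 1 := by
  simp only [Complex.normSq_eq_norm_sq]
  rw [← Fin.sum_univ_four (fun i => ‖x i‖ ^ 2), ← EuclideanSpace.norm_sq_eq]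
  constructor
  · intro h
    rw [h, one_pow]
  · intro h
    nlinarith [norm_nonneg x]

lemma forall_fin_four {p : Fin 4 → Prop} : (∀ i, p i) ↔ p 0 ∧ p 1 ∧ p 2 ∧ p 3 := by
  simp [Fin.forall_fin_succ]


lemma uncorrelated_shift_one_iff (a b c d : ℂ) :
    Uncorrelated (1 / 5) (d * conj a) (a * conj b) (b * conj c) (c * conj d) ↔
      (normSq a + normSq c) * (normSq b + normSq d) = 1 / 5 ∧
      (a * conj c).re * (b * conj d).re = 0 ∧
      a * c * (conj b ^ 2 + conj d ^ 2) + b * d * (conj a ^ 2 + conj c ^ 2) = 0 := by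
  unfold Uncorrelated
  refine and_congr ?_ (and_congr ?_ ?_)
  · simp only [normSq_mul, normSq_conj]
    constructor <;> intro h <;> linear_combination h
  · simp only [add_re, mul_re, mul_im, conj_re, conj_im]
    constructor <;> intro h
    · linear_combination h / 2
    · linear_combination 2 * h
  · rw [← map_eq_zero_iff (starRingEnd ℂ) (starRingEnd ℂ).injective]
    simp only [map_add, map_mul, conj_conj]
    constructor <;> intro h <;> linear_combination h

/-- The shifts $1$ and $3$ are inverse to each other, so they yield the same conditions. -/
lemma uncorrelated_shift_three_iff (a b c d : ℂ) :
    Uncorrelated (1 / 5) (b * conj a) (c * conj b) (d * conj c) (a * conj d) ↔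
      (normSq a + normSq c) * (normSq b + normSq d) = 1 / 5 ∧
      (a * conj c).re * (b * conj d).re = 0 ∧
      a * c * (conj b ^ 2 + conj d ^ 2) + b * d * (conj a ^ 2 + conj c ^ 2) = 0 := by
  unfold Uncorrelated
  refine and_congr ?_ (and_congr ?_ ?_)
  · simp only [normSq_mul, normSq_conj]
    constructor <;> intro h <;> linear_combination h
  · simp only [add_re, mul_re, mul_im, conj_re, conj_im]
    constructor <;> intro h
    · linear_combination h / 2
    · linear_combination 2 * h
  · simp only [map_mul, conj_conj]
    constructor <;> intro h <;> linear_combination h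

lemma uncorrelated_shift_two_iff (a b c d : ℂ) :
    Uncorrelated (1 / 5) (c * conj a) (d * conj b) (a * conj c) (b * conj d) ↔
      normSq a * normSq c + normSq b * normSq d = 1 / 10 ∧
      ((a * conj c) ^ 2 + (b * conj d) ^ 2).re = 0 ∧
      (a * conj c).re * (b * conj d).re = 0 := by
  unfold Uncorrelated
  refine and_congr ?_ (and_congr ?_ ?_)
  · simp only [normSq_mul, normSq_conj]
    constructor <;> intro h
    · linear_combination h / 2
    · linear_combination 2 * h
  · simp only [map_mul, conj_conj]
    rw [show a * conj c * (conj c * a) + b * conj d * (conj d * b) =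
      (a * conj c) ^ 2 + (b * conj d) ^ 2 by ring]
  · rw [Complex.ext_iff]
    simp only [add_re, add_im, mul_re, mul_im, conj_re, conj_im, zero_re, zero_im]
    constructor
    · rintro ⟨h, -⟩
      linear_combination h / 4
    · intro h
      refine ⟨?_, ?_⟩
      · linear_combination 4 * h
      · ring

/-- Shift $0$ contributes three flatness conditions instead of four, since $j=k=0$ is the
normalization itself. -/
lemma sol_iff (a b c d : ℂ) : Sol a b c d ↔
    normSq a + normSq b + normSq c + normSq d = 1 ∧
    (normSq (a * conj a + I * (b * conj b) - c * conj c - I * (d * conj d)) = 1 / 5 ∧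
      normSq (a * conj a - b * conj b + c * conj c - d * conj d) = 1 / 5 ∧
      normSq (a * conj a - I * (b * conj b) - c * conj c + I * (d * conj d)) = 1 / 5) ∧
    Uncorrelated (1 / 5) (d * conj a) (a * conj b) (b * conj c) (c * conj d) ∧
    Uncorrelated (1 / 5) (c * conj a) (d * conj b) (a * conj c) (b * conj d) ∧
    Uncorrelated (1 / 5) (b * conj a) (c * conj b) (d * conj c) (a * conj d) := by
  rw [uncorrelated_shift_one_iff, uncorrelated_shift_two_iff, uncorrelated_shift_three_iff]
  simp only [Complex.mul_conj]
  have e1 : ∀ p q r s : ℝ, normSq ((p : ℂ) + I * q - r - I * s) = (p - r) ^ 2 + (q - s) ^ 2 := by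
    intro p q r s
    simp only [normSq_apply, add_re, add_im, sub_re, sub_im, mul_re, mul_im, I_re, I_im, ofReal_re,
      ofReal_im]
    ring
  have e2 : ∀ p q r s : ℝ, normSq ((p : ℂ) - I * q - r + I * s) = (p - r) ^ 2 + (q - s) ^ 2 := by
    intro p q r s
    simp only [normSq_apply, add_re, add_im, sub_re, sub_im, mul_re, mul_im, I_re, I_im, ofReal_re,
      ofReal_im]
    ring
  have e3 : ∀ p q r s : ℝ, normSq ((p : ℂ) - q + r - s) = (p - q + r - s) ^ 2 := by
    intro p q r s
    simp only [normSq_apply, add_re, add_im, sub_re, sub_im, ofReal_re, ofReal_im]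
    ring
  rw [e1, e2, e3]
  constructor
  · rintro ⟨h1, h2, h3, h4, h5, h6, h7⟩
    have f1 : (normSq a - normSq c) ^ 2 + (normSq b - normSq d) ^ 2 = 1 / 5 := by
      linear_combination h2 - 2 * h4
    refine ⟨h1, ⟨f1, ?_, f1⟩, ⟨h3, h5, h7⟩, ⟨h4, h6, h5⟩, ⟨h3, h5, h7⟩⟩
    -- The square of the alternating sum is the squared total minus four times `cross`, that is
    -- $1-4/5$.
    linear_combination
      (normSq a + normSq b + normSq c + normSq d + 1) * h1 - 4 * h3
  · rintro ⟨h1, ⟨f1, -, -⟩, -, ⟨h4, h6, -⟩, ⟨h3, h5, h7⟩⟩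
    refine ⟨h1, ?_, h3, h4, h5, h6, h7⟩
    linear_combination f1 + 2 * h4

theorem isFiducial_iff_sol (x : EuclideanSpace ℂ (Fin 4)) :
    IsFiducial 4 x ↔ Sol (x 0) (x 1) (x 2) (x 3) := by
  have hflat : ∀ (k : Fin 4) (y₀ y₁ y₂ y₃ : ℂ), x (0 - k) * conj (x 0 : ℂ) = y₀ →
      x (1 - k) * conj (x 1 : ℂ) = y₁ → x (2 - k) * conj (x 2 : ℂ) = y₂ →
      x (3 - k) * conj (x 3 : ℂ) = y₃ →
      ((∀ j : Fin 4, ‖inner ℂ x (weyl j k x)‖ ^ 2 = 1 / 5) ↔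
        Uncorrelated (1 / 5) y₀ y₁ y₂ y₃) := by
    intro k y₀ y₁ y₂ y₃ h₀ h₁ h₂ h₃
    obtain ⟨f0, f1, f2, f3⟩ := norm_sq_inner_weyl k x y₀ y₁ y₂ y₃ h₀ h₁ h₂ h₃
    rw [forall_fin_four (p := fun j => ‖inner ℂ x (weyl j k x)‖ ^ 2 = 1 / 5), f0, f1, f2, f3,
      fourier_flat]
  obtain ⟨-, f1, f2, f3⟩ := norm_sq_inner_weyl 0 x _ _ _ _ rfl rfl rfl rfl
  have h1 := hflat 1 (x 3 * conj (x 0 : ℂ)) (x 0 * conj (x 1 : ℂ)) (x 1 * conj (x 2 : ℂ))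
    (x 2 * conj (x 3 : ℂ)) rfl rfl rfl rfl
  have h2 := hflat 2 (x 2 * conj (x 0 : ℂ)) (x 3 * conj (x 1 : ℂ)) (x 0 * conj (x 2 : ℂ))
    (x 1 * conj (x 3 : ℂ)) rfl rfl rfl rfl
  have h3 := hflat 3 (x 1 * conj (x 0 : ℂ)) (x 2 * conj (x 1 : ℂ)) (x 3 * conj (x 2 : ℂ))
    (x 0 * conj (x 3 : ℂ)) rfl rfl rfl rfl
  rw [isFiducial_iff_overlap, sol_iff, ← h1, ← h2, ← h3, norm_eq_one_iff]
  refine and_congr_right fun _ => ?_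
  simp only [sub_zero] at f1 f2 f3
  rw [← f1, ← f2, ← f3]
  constructor
  · intro h
    have hk : ∀ k : Fin 4, k ≠ 0 → ∀ j : Fin 4, (j, k) ≠ (0, 0) :=
      fun k hk j he => hk (Prod.mk.inj he).2
    exact ⟨⟨h 1 0 (by decide), h 2 0 (by decide), h 3 0 (by decide)⟩,
      fun j => h j 1 (hk _ (by decide) j), fun j => h j 2 (hk _ (by decide) j),
      fun j => h j 3 (hk _ (by decide) j)⟩
  · rintro ⟨g0, g1, g2, g3⟩ j k hjk
    have : ∀ k : Fin 4, ∀ j : Fin 4, (j, k) ≠ (0, 0) →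
        ‖inner ℂ x (weyl j k x)‖ ^ 2 = 1 / 5 := by
      rw [forall_fin_four]
      refine ⟨?_, fun j _ => g1 j, fun j _ => g2 j, fun j _ => g3 j⟩
      rw [forall_fin_four]
      exact ⟨fun h => absurd rfl h, fun _ => g0.1, fun _ => g0.2.1, fun _ => g0.2.2⟩
    exact this k j hjk

/-! ### Arithmetic of the radii -/

lemma sqrt_five_sq : √5 ^ 2 = (5 : ℝ) := Real.sq_sqrt (by norm_num)

lemma sqrt_two_sq : √2 ^ 2 = (2 : ℝ) := Real.sq_sqrt (by norm_num)

lemma sqrt_five_pos : (0 : ℝ) < √5 := Real.sqrt_pos.2 (by norm_num)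

lemma sqrt_two_pos : (0 : ℝ) < √2 := Real.sqrt_pos.2 (by norm_num)

lemma sqrt_five_lt : √5 < (9 / 4 : ℝ) := by
  rw [Real.sqrt_lt' (by norm_num)]
  norm_num

lemma lt_sqrt_five : (2 : ℝ) < √5 := by
  rw [Real.lt_sqrt (by norm_num)]
  norm_num

lemma sqrt_two_lt : √2 < (3 / 2 : ℝ) := by
  rw [Real.sqrt_lt' (by norm_num)]
  norm_num

lemma one_lt_sqrt_two : (1 : ℝ) < √2 := by
  rw [Real.lt_sqrt (by norm_num)]
  norm_num

lemma one_div_sqrt_five : 1 / √5 = √5 / 5 := by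
  rw [div_eq_div_iff sqrt_five_pos.ne' (by norm_num)]
  linear_combination -sqrt_five_sq

/-- Twice the difference of `r₊²` and `r₋²`. -/
noncomputable def kappa : ℝ := √(1 / 5 + 1 / √5)

lemma kappa_sq : kappa ^ 2 = 1 / 5 + √5 / 5 := by
  rw [kappa, Real.sq_sqrt (by positivity), one_div_sqrt_five]

lemma kappa_pos : 0 < kappa := Real.sqrt_pos.2 (by positivity)

lemma kappa_lt : kappa < 1 + √5 / 5 := by
  have := sqrt_five_pos
  have := sqrt_five_sq
  have := kappa_sq
  nlinarith [kappa_pos]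

lemma r0_sq : r0 ^ 2 = (1 - √5 / 5) * (2 + √2) / 8 := by
  have h1 : (0 : ℝ) ≤ 1 - √5 / 5 := by linarith [sqrt_five_lt]
  have h2 : (0 : ℝ) < 2 - √2 := by linarith [sqrt_two_lt]
  rw [r0, div_pow, mul_pow, one_div_sqrt_five, Real.sq_sqrt h1, Real.sq_sqrt h2.le,
    div_eq_div_iff (by positivity) (by norm_num)]
  linear_combination 4 * (1 - √5 / 5) * sqrt_two_sq

lemma r0_pos : 0 < r0 := by
  have h1 : (0 : ℝ) < 1 - 1 / √5 := by
    rw [one_div_sqrt_five]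
    linarith [sqrt_five_lt]
  have h2 : (0 : ℝ) < 2 - √2 := by linarith [sqrt_two_lt]
  exact div_pos (Real.sqrt_pos.2 h1) (mul_pos two_pos (Real.sqrt_pos.2 h2))

lemma r1_sq : r1 ^ 2 = (1 - √5 / 5) * (2 - √2) / 8 := by
  rw [r1, mul_pow, r0_sq]
  linear_combination (1 - √5 / 5) * √2 / 8 * sqrt_two_sq

lemma r1_pos : 0 < r1 := mul_pos (by linarith [one_lt_sqrt_two]) r0_pos

lemma r0_mul_r1 : r0 * r1 = (1 - √5 / 5) * √2 / 8 := by
  rw [r1]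
  linear_combination (√2 - 1) * r0_sq + (1 - √5 / 5) / 8 * sqrt_two_sq

lemma rPlus_sq : rPlus ^ 2 = (1 + √5 / 5 + kappa) / 4 := by
  have := kappa_pos
  change (1 / 2 * √(1 + 1 / √5 + kappa)) ^ 2 = _
  rw [mul_pow, Real.sq_sqrt (by positivity), one_div_sqrt_five]
  ring

lemma rPlus_pos : 0 < rPlus := by
  have := kappa_pos
  change 0 < 1 / 2 * √(1 + 1 / √5 + kappa)
  positivity

lemma rMinus_sq : rMinus ^ 2 = (1 + √5 / 5 - kappa) / 4 := by
  have := kappa_lt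
  change (1 / 2 * √(1 + 1 / √5 - kappa)) ^ 2 = _
  rw [one_div_sqrt_five, mul_pow, Real.sq_sqrt (by linarith)]
  ring

lemma rMinus_pos : 0 < rMinus := by
  have := kappa_lt
  change 0 < 1 / 2 * √(1 + 1 / √5 - kappa)
  rw [one_div_sqrt_five]
  exact mul_pos (by norm_num) (Real.sqrt_pos.2 (by linarith))

lemma rPlus_sq_mul_rMinus_sq : rPlus ^ 2 * rMinus ^ 2 = (1 + √5 / 5) / 16 := by
  rw [rPlus_sq, rMinus_sq]
  linear_combination sqrt_five_sq / 400 - kappa_sq / 16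

/-! ### Symmetries of the equations and determination of the moduli -/

lemma Sol.rotate {x₀ x₁ x₂ x₃ : ℂ} (h : Sol x₀ x₁ x₂ x₃) : Sol x₁ x₂ x₃ x₀ := by
  obtain ⟨h1, h2, h3, h4, h5, h6, h7⟩ := h
  refine ⟨?_, ?_, ?_, ?_, ?_, ?_, ?_⟩
  · linear_combination h1
  · linear_combination h2
  · linear_combination h3
  · linear_combination h4
  · simp only [mul_re, conj_re, conj_im] at h5 ⊢
    linear_combination h5
  · simp only [mul_re, mul_im, conj_re, conj_im, pow_two, add_re] at h6 ⊢
    linear_combination h6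
  · linear_combination h7

lemma Sol.swap {x₀ x₁ x₂ x₃ : ℂ} (h : Sol x₀ x₁ x₂ x₃) : Sol x₀ x₃ x₂ x₁ := by
  obtain ⟨h1, h2, h3, h4, h5, h6, h7⟩ := h
  refine ⟨?_, ?_, ?_, ?_, ?_, ?_, ?_⟩
  · linear_combination h1
  · linear_combination h2
  · linear_combination h3
  · linear_combination h4
  · simp only [mul_re, conj_re, conj_im] at h5 ⊢
    linear_combination h5
  · simp only [mul_re, mul_im, conj_re, conj_im, pow_two, add_re] at h6 ⊢
    linear_combination h6
  · linear_combination h7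

lemma mul_conj_of_norm_eq_one {z : ℂ} (hz : ‖z‖ = 1) : z * conj z = 1 := by
  rw [Complex.mul_conj, Complex.normSq_eq_norm_sq, hz]
  norm_num

lemma Sol.smul {x₀ x₁ x₂ x₃ : ℂ} (h : Sol x₀ x₁ x₂ x₃) {z : ℂ} (hz : ‖z‖ = 1) :
    Sol (z * x₀) (z * x₁) (z * x₂) (z * x₃) := by
  have hn : ∀ x : ℂ, normSq (z * x) = normSq x := by
    intro x
    rw [normSq_mul, Complex.normSq_eq_norm_sq z, hz]
    ring
  have hc : ∀ x y : ℂ, z * x * conj (z * y) = x * conj y := by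
    intro x y
    rw [map_mul]
    linear_combination x * conj y * mul_conj_of_norm_eq_one hz
  obtain ⟨h1, h2, h3, h4, h5, h6, h7⟩ := h
  refine ⟨by simpa only [hn], by simpa only [hn], by simpa only [hn], by simpa only [hn],
    by simpa only [hc], by simpa only [hc], ?_⟩
  simp only [map_mul]
  linear_combination (z * conj z) ^ 2 * h7

/-- The moduli of a solution, when `x₀ x̄₂` is the imaginary one of the two products. -/
lemma Sol.moduli {x₀ x₁ x₂ x₃ : ℂ} (h : Sol x₀ x₁ x₂ x₃) (hre : (x₀ * conj x₂).re = 0)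
    (hle : normSq x₂ ≤ normSq x₀) :
    normSq x₀ = r0 ^ 2 ∧ normSq x₂ = r1 ^ 2 ∧
      ((normSq x₁ = rPlus ^ 2 ∧ normSq x₃ = rMinus ^ 2) ∨
        (normSq x₁ = rMinus ^ 2 ∧ normSq x₃ = rPlus ^ 2)) := by
  obtain ⟨h1, h2, h3, h4, h5, h6, h7⟩ := h
  have hu : ((x₀ * conj x₂) ^ 2).re = - (normSq x₀ * normSq x₂) := by
    have e : normSq (x₀ * conj x₂) = normSq x₀ * normSq x₂ := by rw [normSq_mul, normSq_conj]
    rw [← e, normSq_apply, pow_two, mul_re, hre]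
    ring
  have hv : ((x₁ * conj x₃) ^ 2).re = normSq x₀ * normSq x₂ := by
    rw [add_re] at h6
    linarith
  -- This inequality, from $\mathrm{Re}\,z\le|z|$, later discards the wrong root for
  -- $|x_0|^2+|x_2|^2$.
  have hAB : normSq x₀ * normSq x₂ ≤ normSq x₁ * normSq x₃ := by
    rw [← hv]
    refine (re_le_norm _).trans (le_of_eq ?_)
    rw [norm_pow, ← Complex.normSq_eq_norm_sq, normSq_mul, normSq_conj]
  have hsum : ∀ x y : ℂ, normSq (conj x ^ 2 + conj y ^ 2) =
      normSq x ^ 2 + normSq y ^ 2 + 2 * ((x * conj y) ^ 2).re := by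
    intro x y
    simp only [normSq_apply, add_re, add_im, mul_re, mul_im, pow_two, conj_re, conj_im]
    ring
  -- The squared modulus of the `phase` equation; `hu` and `hv` eliminate the remaining arguments.
  have h8 : normSq x₀ * normSq x₂ *
        (normSq x₁ ^ 2 + normSq x₃ ^ 2 + 2 * (normSq x₀ * normSq x₂)) =
      normSq x₁ * normSq x₃ * (normSq x₀ ^ 2 + normSq x₂ ^ 2 - 2 * (normSq x₀ * normSq x₂)) := by
    have := congrArg normSq (eq_neg_of_add_eq_zero_left h7)
    rw [normSq_neg, normSq_mul, normSq_mul, normSq_mul, normSq_mul, hsum, hsum, hu, hv] at this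
    linarith
  clear hu hv h5 h6 h7 hre hsum
  generalize normSq x₀ = p at *
  generalize normSq x₁ = q at *
  generalize normSq x₂ = r at *
  generalize normSq x₃ = t at *
  have hA : p * r = (p + r) ^ 2 / 8 := by
    have e1 : q = 1 - p - r - t := by linarith
    subst e1
    have e2 : (1 - p - r - t) * t = 1 / 10 - p * r := by linarith
    have e3 : (1 - p - r - t) ^ 2 + t ^ 2 = (1 - p - r) ^ 2 - 2 * (1 / 10 - p * r) := by
      linear_combination -2 * e2
    rw [e2, e3] at h8
    linear_combination 5 / 4 * h8 + 5 / 4 * 2 * (p * r) * h3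
  have hs : p + r = (1 - √5 / 5) / 2 := by
    -- The sums $p+r$ and $q+t$ add up to $1$ and have product $1/5$, so they are the two roots of a
    -- quadratic.
    have e : (p + r - (1 - √5 / 5) / 2) * (p + r - (1 + √5 / 5) / 2) = 0 := by
      linear_combination (p + r) * h1 - h3 - sqrt_five_sq / 100
    rcases mul_eq_zero.1 e with e | e
    · linarith
    -- The larger root gives $pr>1/20$, whereas $pr\le qt$ and $pr+qt=1/10$.
    · exfalso
      have e' : p + r = (1 + √5 / 5) / 2 := by linarith
      rw [e'] at hA
      nlinarith [sqrt_five_sq, lt_sqrt_five]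
  have hs' : q + t = (1 + √5 / 5) / 2 := by linarith
  have hd : p - r = (1 - √5 / 5) * √2 / 4 := by
    have hpos : 0 < (1 - √5 / 5) * √2 / 4 := by
      have : 0 < 1 - √5 / 5 := by linarith [sqrt_five_lt]
      have := sqrt_two_pos
      positivity
    have e : (p - r) ^ 2 = ((1 - √5 / 5) * √2 / 4) ^ 2 := by
      have : (p - r) ^ 2 = (p + r) ^ 2 / 2 := by linear_combination -4 * hA
      rw [this, hs]
      linear_combination -(1 - √5 / 5) ^ 2 / 16 * sqrt_two_sq
    exact (sq_eq_sq₀ (by linarith) hpos.le).1 e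
  refine ⟨?_, ?_, ?_⟩
  · rw [r0_sq]
    linear_combination hs / 2 + hd / 2
  · rw [r1_sq]
    linear_combination hs / 2 - hd / 2
  · have e : (q - t - kappa / 2) * (q - t + kappa / 2) = 0 := by
      have e1 : (p + r) ^ 2 = ((1 - √5 / 5) / 2) ^ 2 := by rw [hs]
      have e2 : (q + t) ^ 2 = ((1 + √5 / 5) / 2) ^ 2 := by rw [hs']
      linear_combination e2 - 4 * h4 + 4 * hA + e1 / 2 - kappa_sq / 4 + 3 / 200 * sqrt_five_sq
    rw [rPlus_sq, rMinus_sq]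
    rcases mul_eq_zero.1 e with e | e
    · left
      constructor <;> linarith
    · right
      constructor <;> linarith

/-! ### Equations for the phases -/

/-- The equations for the phases of a solution. -/
structure PhaseEq (u v w : ℂ) : Prop where
  re_eq : v.re = 0
  re_sq : ((u * conj w) ^ 2).re = 1 - 2 * (√5 / 5)
  sum_eq : v * (rPlus ^ 2 * conj u ^ 2 + rMinus ^ 2 * conj w ^ 2) +
    2 * rPlus * rMinus * (u * w) = 0

lemma conj_sq_of_re_eq_zero {v : ℂ} (hv : ‖v‖ = 1) (hre : v.re = 0) : conj v ^ 2 = -1 := by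
  have h : normSq v = 1 := by rw [Complex.normSq_eq_norm_sq, hv, one_pow]
  rw [normSq_apply, hre] at h
  rw [Complex.ext_iff]
  simp only [pow_two, mul_re, mul_im, conj_re, conj_im, hre, neg_re, neg_im, one_re, one_im]
  constructor
  · linear_combination -h
  · ring

/-- The equations in the moduli hold identically for these radii. The common factor $r_0r_1$ leaves
the `phase` equation because $t=\sqrt2-1$ satisfies $1-t^2=2t$. -/
lemma sol_iff_phaseEq {u v w : ℂ} (hu : ‖u‖ = 1) (hv : ‖v‖ = 1) (hw : ‖w‖ = 1)
    (hre : v.re = 0) :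
    Sol r0 (rPlus * u) (r1 * v) (rMinus * w) ↔ PhaseEq u v w := by
  have hn : ∀ (r : ℝ) (z : ℂ), ‖z‖ = 1 → normSq (r * z) = r ^ 2 := by
    intro r z hz
    rw [normSq_mul, normSq_ofReal, Complex.normSq_eq_norm_sq, hz]
    ring
  have hv2 := conj_sq_of_re_eq_zero hv hre
  have n0 : normSq (r0 : ℂ) = r0 ^ 2 := by rw [normSq_ofReal]; ring
  have hB := rPlus_sq_mul_rMinus_sq
  have hk := kappa_sq
  have h5 := sqrt_five_sq
  have h2 := sqrt_two_sq
  have e1 : (((r0 : ℂ) * conj (r1 * v)) ^ 2 + (rPlus * u * conj (rMinus * w)) ^ 2).re =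
      -(r0 * r1) ^ 2 + rPlus ^ 2 * rMinus ^ 2 * ((u * conj w) ^ 2).re := by
    have : ((r0 : ℂ) * conj (r1 * v)) ^ 2 + (rPlus * u * conj (rMinus * w)) ^ 2 =
        ((-(r0 * r1) ^ 2 : ℝ) : ℂ) + ((rPlus ^ 2 * rMinus ^ 2 : ℝ) : ℂ) * (u * conj w) ^ 2 := by
      simp only [map_mul, conj_ofReal]
      push_cast
      linear_combination (r0 * r1 : ℂ) ^ 2 * hv2
    rw [this, add_re, ofReal_re, re_ofReal_mul]
  have e2 : (r0 : ℂ) * (r1 * v) * (conj (rPlus * u) ^ 2 + conj (rMinus * w) ^ 2) +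
      (rPlus * u) * (rMinus * w) * (conj (r0 : ℂ) ^ 2 + conj (r1 * v) ^ 2) =
      ((r0 * r1 : ℝ) : ℂ) * (v * (rPlus ^ 2 * conj u ^ 2 + rMinus ^ 2 * conj w ^ 2) +
        2 * rPlus * rMinus * (u * w)) := by
    have hd : ((r0 ^ 2 - r1 ^ 2 : ℝ) : ℂ) = ((2 * (r0 * r1) : ℝ) : ℂ) := by
      congr 1
      rw [r0_sq, r1_sq, r0_mul_r1]
      ring
    simp only [map_mul, conj_ofReal]
    push_cast at hd ⊢
    linear_combination (rPlus * u) * (rMinus * w) * r1 ^ 2 * hv2 +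
      (rPlus * u) * (rMinus * w) * hd
  have hpos : rPlus ^ 2 * rMinus ^ 2 ≠ 0 := by
    have := rPlus_pos
    have := rMinus_pos
    positivity
  have hval : (r0 * r1) ^ 2 = rPlus ^ 2 * rMinus ^ 2 * (1 - 2 * (√5 / 5)) := by
    rw [hB, r0_mul_r1]
    linear_combination (1 - √5 / 5) ^ 2 / 64 * h2 + (1 / 800 + 1 / 200) * h5
  have h01 : ((r0 * r1 : ℝ) : ℂ) ≠ 0 :=
    ofReal_ne_zero.2 (mul_pos r0_pos r1_pos).ne'
  constructor
  · intro h
    refine ⟨hre, ?_, ?_⟩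
    · have := h.re_sq
      rw [e1, hval] at this
      apply mul_left_cancel₀ hpos
      linarith
    · have := h.phase
      rw [e2] at this
      exact (mul_eq_zero.1 this).resolve_left h01
  · intro h
    refine ⟨?_, ?_, ?_, ?_, ?_, ?_, ?_⟩
    · rw [n0, hn _ _ hu, hn _ _ hv, hn _ _ hw, r0_sq, r1_sq, rPlus_sq, rMinus_sq]
      ring
    · rw [n0, hn _ _ hu, hn _ _ hv, hn _ _ hw, r0_sq, r1_sq, rPlus_sq, rMinus_sq]
      linear_combination hk / 8 + (1 - √5 / 5) ^ 2 / 32 * h2 + 1 / 80 * h5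
    · rw [n0, hn _ _ hu, hn _ _ hv, hn _ _ hw, r0_sq, r1_sq, rPlus_sq, rMinus_sq]
      linear_combination -h5 / 100
    · rw [n0, hn _ _ hu, hn _ _ hv, hn _ _ hw, hB, r0_sq, r1_sq]
      linear_combination -(1 - √5 / 5) ^ 2 / 64 * h2 + h5 / 800
    · rw [map_mul, conj_ofReal, re_ofReal_mul, re_ofReal_mul, conj_re, hre]
      ring
    · rw [e1, h.re_sq, hval]
      ring
    · rw [e2, h.sum_eq, mul_zero]

/-! ### Phase factors of the explicit angles -/

noncomputable def thetaPlus (j m n : ℕ) : ℝ :=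
  (-1) ^ m * (a / 2 + b / 4) + Real.pi * (m + 2 * n + 7 * j + 1) / 4

noncomputable def theta1 (k : ℕ) : ℝ := Real.pi * (2 * k + 1) / 2

noncomputable def thetaMinus (j k m n : ℕ) : ℝ :=
  (-1) ^ m * (-a / 2 + b / 4) + Real.pi * (m + 2 * n + 3 * j + 4 * k + 1) / 4

/-- The phase factor `e^{iθ}`. -/
noncomputable def cis (θ : ℝ) : ℂ := Complex.exp (θ * I)

lemma polar_eq (r θ : ℝ) : polar r θ = r * cis θ := rfl

lemma norm_cis (θ : ℝ) : ‖cis θ‖ = 1 := Complex.norm_exp_ofReal_mul_I θ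

lemma cis_ne_zero (θ : ℝ) : cis θ ≠ 0 := Complex.exp_ne_zero _

lemma cis_add (x y : ℝ) : cis (x + y) = cis x * cis y := by
  rw [cis, cis, cis, ← Complex.exp_add]
  congr 1
  push_cast
  ring

lemma conj_cis (x : ℝ) : conj (cis x) = cis (-x) := by
  rw [cis, cis, ← Complex.exp_conj, map_mul, conj_I, conj_ofReal]
  congr 1
  push_cast
  ring

lemma cis_nat_mul_pi (n : ℕ) : cis (n * Real.pi) = (-1) ^ n := by
  rw [cis, ← Complex.exp_pi_mul_I, ← Complex.exp_nat_mul]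
  congr 1
  push_cast
  ring

lemma cis_nat_mul_pi_div_two (n : ℕ) : cis (n * (Real.pi / 2)) = I ^ n := by
  rw [cis, show ((n * (Real.pi / 2) : ℝ) : ℂ) * I = n * (Real.pi / 2 * I) by push_cast; ring,
    Complex.exp_nat_mul, Complex.exp_pi_div_two_mul_I]

lemma cis_re (x : ℝ) : (cis x).re = Real.cos x := Complex.exp_ofReal_mul_I_re x

lemma cis_im (x : ℝ) : (cis x).im = Real.sin x := Complex.exp_ofReal_mul_I_im x

lemma neg_one_pow_congr {m n : ℕ} (h : m % 2 = n % 2) : (-1 : ℂ) ^ m = (-1) ^ n := by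
  rw [neg_one_pow_eq_pow_mod_two, h, ← neg_one_pow_eq_pow_mod_two]

lemma cis_theta1 (k : ℕ) : cis (theta1 k) = (-1) ^ k * I := by
  rw [← cis_nat_mul_pi, ← pow_one I, ← cis_nat_mul_pi_div_two, ← cis_add, theta1]
  congr 1
  push_cast
  ring

lemma cis_thetaPlus_mul_conj (j k m n : ℕ) :
    cis (thetaPlus j m n) * conj (cis (thetaMinus j k m n)) =
      (-1) ^ (j + k) * cis ((-1) ^ m * a) := by
  -- The difference of the angles contains $(j-k)\pi$; adding $2k\pi$ makes the coefficient the
  -- natural number $j+k$.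
  have h : (1 : ℂ) = cis ((2 * k : ℕ) * Real.pi) := by
    rw [cis_nat_mul_pi]
    simp
  rw [conj_cis, ← cis_add, ← cis_nat_mul_pi, ← mul_one (cis _), h, ← cis_add, ← cis_add, thetaPlus,
    thetaMinus]
  congr 1
  push_cast
  ring

lemma cis_thetaPlus_mul_thetaMinus_sq (j k m n : ℕ) :
    (cis (thetaPlus j m n) * cis (thetaMinus j k m n)) ^ 2 =
      (-1) ^ (m + j + 1) * cis ((-1) ^ m * b) := by
  -- This exponent is the exact coefficient of $\pi$ in $2(\theta_++\theta_-)$.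
  rw [neg_one_pow_congr (n := m + 5 * j + 2 * k + 2 * n + 1) (by omega), ← cis_nat_mul_pi,
    pow_two, ← cis_add, ← cis_add, ← cis_add, thetaPlus, thetaMinus]
  congr 1
  push_cast
  ring

lemma cis_thetaPlus_add (j m n : ℕ) :
    cis (thetaPlus j m n) = I ^ n * cis (thetaPlus j m 0) := by
  rw [← cis_nat_mul_pi_div_two, ← cis_add, thetaPlus, thetaPlus]
  congr 1
  push_cast
  ring

lemma cis_thetaMinus_add (j k m n : ℕ) :
    cis (thetaMinus j k m n) = I ^ n * cis (thetaMinus j k m 0) := by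
  rw [← cis_nat_mul_pi_div_two, ← cis_add, thetaMinus, thetaMinus]
  congr 1
  push_cast
  ring

/-! ### The angles $a$ and $b$ and the phase identity -/

lemma two_div_sqrt_sq : (2 / √(5 + √5)) ^ 2 = 1 - √5 / 5 := by
  have h5 := sqrt_five_pos
  rw [div_pow, Real.sq_sqrt (by positivity), eq_comm, eq_div_iff (by positivity)]
  linear_combination -sqrt_five_sq / 5

lemma cos_a : Real.cos a = 2 / √(5 + √5) := by
  have h : (0 : ℝ) ≤ 2 / √(5 + √5) := by positivity
  rw [a, Real.cos_arccos (by linarith)]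
  refine (sq_le_one_iff₀ h).1 ?_
  rw [two_div_sqrt_sq]
  linarith [sqrt_five_pos]

lemma cos_a_sq : Real.cos a ^ 2 = 1 - √5 / 5 := by
  rw [cos_a, two_div_sqrt_sq]

lemma cos_a_pos : 0 < Real.cos a := by
  rw [cos_a]
  positivity

lemma sin_a_sq : Real.sin a ^ 2 = √5 / 5 := by
  linear_combination Real.sin_sq_add_cos_sq a - cos_a_sq

lemma sin_a_pos : 0 < Real.sin a := by
  have h : 0 ≤ Real.sin a :=
    Real.sin_nonneg_of_nonneg_of_le_pi (Real.arccos_nonneg _) (Real.arccos_le_pi _)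
  refine lt_of_le_of_ne h fun h0 => ?_
  have := sin_a_sq
  rw [← h0] at this
  linarith [sqrt_five_pos]

lemma two_div_sqrt_five_le : 2 / √5 ≤ 1 := by
  rw [div_le_one sqrt_five_pos]
  exact lt_sqrt_five.le

lemma sin_b : Real.sin b = 2 * (√5 / 5) := by
  have h : (0 : ℝ) ≤ 2 / √5 := by positivity
  rw [b, Real.sin_arcsin (by linarith) two_div_sqrt_five_le, ← one_div_sqrt_five]
  ring

lemma cos_b : Real.cos b = √5 / 5 := by
  have h5 := sqrt_five_pos
  rw [b, Real.cos_arcsin, div_pow, sqrt_five_sq,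
    show (1 : ℝ) - 2 ^ 2 / 5 = (√5 / 5) ^ 2 by rw [div_pow, sqrt_five_sq]; norm_num,
    Real.sqrt_sq (by positivity)]

/-- The equation that fixes the sum of the two phases. -/
lemma phase_identity :
    I * (rPlus ^ 2 * cis (-a) + rMinus ^ 2 * cis a) = 2 * rPlus * rMinus * cis b := by
  have hp := rPlus_pos
  have hm := rMinus_pos
  have h5 := sqrt_five_pos
  have hk := kappa_pos
  -- `hs` and `hc` are the real and imaginary parts; all factors are positive, so it suffices to
  -- compare squares.
  have hs : (rPlus ^ 2 - rMinus ^ 2) * Real.sin a = 2 * rPlus * rMinus * Real.cos b := by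
    have e : rPlus ^ 2 - rMinus ^ 2 = kappa / 2 := by
      rw [rPlus_sq, rMinus_sq]
      ring
    rw [e, cos_b]
    have hsin := sin_a_pos
    refine (sq_eq_sq₀ (by positivity) (by positivity)).1 ?_
    linear_combination kappa ^ 2 / 4 * sin_a_sq + √5 / 20 * kappa_sq -
      4 * (√5 / 5) ^ 2 * rPlus_sq_mul_rMinus_sq - √5 / 500 * sqrt_five_sq
  have hc : (rPlus ^ 2 + rMinus ^ 2) * Real.cos a = 2 * rPlus * rMinus * Real.sin b := by
    have e : rPlus ^ 2 + rMinus ^ 2 = (1 + √5 / 5) / 2 := by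
      rw [rPlus_sq, rMinus_sq]
      ring
    rw [e, sin_b]
    have hcos := cos_a_pos
    refine (sq_eq_sq₀ (by positivity) (by positivity)).1 ?_
    linear_combination (1 + √5 / 5) ^ 2 / 4 * cos_a_sq -
      16 * (√5 / 5) ^ 2 * rPlus_sq_mul_rMinus_sq - (1 / 20 + √5 / 100) * sqrt_five_sq
  rw [Complex.ext_iff]
  have e : ∀ r : ℝ, (r : ℂ) ^ 2 = ((r ^ 2 : ℝ) : ℂ) := fun r => by push_cast; rfl
  have e' : (2 : ℂ) * rPlus * rMinus = ((2 * rPlus * rMinus : ℝ) : ℂ) := by push_cast; rfl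
  rw [e, e, e']
  simp only [mul_re, mul_im, add_re, add_im, I_re, I_im, ofReal_re, ofReal_im, cis_re,
    cis_im, Real.cos_neg, Real.sin_neg]
  constructor
  · linear_combination hs
  · linear_combination hc

lemma phase_identity_pow (m : ℕ) (hm : m < 2) :
    I * (rPlus ^ 2 * cis (-((-1) ^ m * a)) + rMinus ^ 2 * cis ((-1) ^ m * a)) =
      (-1) ^ m * (2 * rPlus * rMinus * cis ((-1) ^ m * b)) := by
  have h := phase_identity
  interval_cases m
  · simpa using h
  -- The case $m=1$ is the complex conjugate of $m=0$; the sign comes from $\bar i=-i$.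
  · have h' := congrArg conj h
    simp only [map_mul, map_add, map_pow, conj_I, conj_ofReal, conj_cis, neg_neg, map_ofNat] at h'
    simp only [pow_one, neg_mul, one_mul, neg_neg]
    linear_combination -h'

lemma mul_conj_cis (x : ℝ) : cis x * conj (cis x) = 1 := mul_conj_of_norm_eq_one (norm_cis x)

/-- The third phase equation in terms of the ratio and the product of the phases. -/
lemma phase_sum_iff {u v w : ℂ} (hu : ‖u‖ = 1) (hw : ‖w‖ = 1) :
    v * (rPlus ^ 2 * conj u ^ 2 + rMinus ^ 2 * conj w ^ 2) + 2 * rPlus * rMinus * (u * w) = 0 ↔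
    v * (rPlus ^ 2 * conj (u * conj w) + rMinus ^ 2 * (u * conj w)) =
      -(2 * rPlus * rMinus * (u * w) ^ 2) := by
  have h1 := mul_conj_of_norm_eq_one hu
  have h2 := mul_conj_of_norm_eq_one hw
  have hne : u * w ≠ 0 := by
    apply mul_ne_zero <;> rw [← norm_ne_zero_iff] <;> simp [hu, hw]
  have e : u * w * (v * (rPlus ^ 2 * conj u ^ 2 + rMinus ^ 2 * conj w ^ 2) +
      2 * rPlus * rMinus * (u * w)) =
      v * (rPlus ^ 2 * conj (u * conj w) + rMinus ^ 2 * (u * conj w)) +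
      2 * rPlus * rMinus * (u * w) ^ 2 := by
    simp only [map_mul, conj_conj]
    linear_combination (v * w * rPlus ^ 2 * conj u) * h1 + (v * u * rMinus ^ 2 * conj w) * h2
  constructor
  · intro h
    rw [h, mul_zero] at e
    linear_combination -e
  · intro h
    rw [h, neg_add_cancel] at e
    exact (mul_eq_zero.1 e).resolve_left hne

lemma phaseEq_cis (j k m n : ℕ) (hm : m < 2) :
    PhaseEq (cis (thetaPlus j m n)) (cis (theta1 k)) (cis (thetaMinus j k m n)) := by
  have hsq : ∀ i : ℕ, ((-1 : ℂ) ^ i) * (-1) ^ i = 1 := fun i => by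
    rw [← mul_pow]
    simp
  refine ⟨?_, ?_, ?_⟩
  · rw [cis_theta1]
    rcases neg_one_pow_eq_or ℂ k with h | h <;> rw [h] <;> simp
  · rw [cis_thetaPlus_mul_conj, mul_pow, pow_two, hsq, one_mul, pow_two, mul_re, cis_re, cis_im]
    have hc : Real.cos ((-1) ^ m * a) = Real.cos a := by interval_cases m <;> simp
    have hs : Real.sin ((-1) ^ m * a) ^ 2 = Real.sin a ^ 2 := by interval_cases m <;> simp
    rw [hc]
    linear_combination cos_a_sq - hs - sin_a_sq
  · rw [phase_sum_iff (norm_cis _) (norm_cis _), cis_theta1, cis_thetaPlus_mul_thetaMinus_sq,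
      cis_thetaPlus_mul_conj, map_mul, conj_cis, map_pow, map_neg, map_one, pow_add, pow_add,
      pow_add]
    linear_combination (-1) ^ j * (-1) ^ k * (-1) ^ k * phase_identity_pow m hm +
      (-1) ^ j * ((-1) ^ m * (2 * rPlus * rMinus * cis ((-1) ^ m * b))) * hsq k

/-! ### Solving the phase equations -/

lemma eq_or_of_re_eq_zero {v : ℂ} (hv : ‖v‖ = 1) (hre : v.re = 0) :
    ∃ k < 2, v = cis (theta1 k) := by
  have h : normSq v = 1 := by rw [Complex.normSq_eq_norm_sq, hv, one_pow]
  rw [normSq_apply, hre] at h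
  have h' : (v.im - 1) * (v.im + 1) = 0 := by linear_combination h
  rcases mul_eq_zero.1 h' with h' | h'
  · refine ⟨0, by norm_num, ?_⟩
    rw [cis_theta1]
    apply Complex.ext <;> simp [hre]
    linarith
  · refine ⟨1, by norm_num, ?_⟩
    rw [cis_theta1]
    apply Complex.ext <;> simp [hre]
    linarith

lemma exists_sign_of_re_sq {e : ℂ} (he : ‖e‖ = 1) (hre : (e ^ 2).re = 1 - 2 * (√5 / 5)) :
    ∃ j < 2, ∃ m < 2, e = (-1) ^ j * cis ((-1) ^ m * a) := by
  have h : normSq e = 1 := by rw [Complex.normSq_eq_norm_sq, he, one_pow]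
  rw [normSq_apply] at h
  rw [pow_two, mul_re] at hre
  have h1 : (e.re - Real.cos a) * (e.re + Real.cos a) = 0 := by
    linear_combination h / 2 + hre / 2 - cos_a_sq
  have h2 : (e.im - Real.sin a) * (e.im + Real.sin a) = 0 := by
    linear_combination h / 2 - hre / 2 - sin_a_sq
  rcases mul_eq_zero.1 h1 with h1 | h1 <;> rcases mul_eq_zero.1 h2 with h2 | h2
  · refine ⟨0, by norm_num, 0, by norm_num, ?_⟩
    apply Complex.ext <;> simp [cis_re, cis_im] <;> linarith
  · refine ⟨0, by norm_num, 1, by norm_num, ?_⟩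
    apply Complex.ext <;> simp [cis_re, cis_im] <;> linarith
  · refine ⟨1, by norm_num, 1, by norm_num, ?_⟩
    apply Complex.ext <;> simp [cis_re, cis_im] <;> linarith
  · refine ⟨1, by norm_num, 0, by norm_num, ?_⟩
    apply Complex.ext <;> simp [cis_re, cis_im] <;> linarith

lemma exists_I_pow_of_pow_four {z : ℂ} (h : z ^ 4 = 1) : ∃ n < 4, z = I ^ n := by
  have e : (z - 1) * ((z + 1) * ((z - I) * (z + I))) = 0 := by
    linear_combination h - (z ^ 2 - 1) * I_sq
  rcases mul_eq_zero.1 e with e | e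
  · exact ⟨0, by norm_num, by linear_combination e⟩
  rcases mul_eq_zero.1 e with e | e
  · exact ⟨2, by norm_num, by rw [I_sq]; linear_combination e⟩
  rcases mul_eq_zero.1 e with e | e
  · exact ⟨1, by norm_num, by linear_combination e⟩
  · exact ⟨3, by norm_num, by rw [I_pow_three]; linear_combination e⟩

theorem PhaseEq.exists_cis {u v w : ℂ} (hu : ‖u‖ = 1) (hv : ‖v‖ = 1) (hw : ‖w‖ = 1)
    (h : PhaseEq u v w) :
    ∃ j k m n : ℕ, j < 2 ∧ k < 2 ∧ m < 2 ∧ n < 4 ∧ u = cis (thetaPlus j m n) ∧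
      v = cis (theta1 k) ∧ w = cis (thetaMinus j k m n) := by
  obtain ⟨k, hk, hvk⟩ := eq_or_of_re_eq_zero hv h.re_eq
  obtain ⟨i, hi, m, hm, hem⟩ := exists_sign_of_re_sq (e := u * conj w)
    (by rw [norm_mul, RCLike.norm_conj, hu, hw, one_mul]) h.re_sq
  -- Chosen so that $j+k\equiv i$ modulo $2$, matching the sign of the ratio in
  -- `cis_thetaPlus_mul_conj`.
  set j := (i + k) % 2 with hj
  have h0 := phaseEq_cis j k m 0 hm
  set U := cis (thetaPlus j m 0) with hU
  set W := cis (thetaMinus j k m 0) with hW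
  have hratio : u * conj w = U * conj W := by
    rw [hem, hU, hW, cis_thetaPlus_mul_conj, neg_one_pow_congr (n := j + k) (by omega)]
  have hprod : (u * w) ^ 2 = (U * W) ^ 2 := by
    have e1 := (phase_sum_iff hu hw).1 h.sum_eq
    have e2 := (phase_sum_iff (norm_cis _) (norm_cis _)).1 h0.sum_eq
    rw [hratio, hvk] at e1
    have hpos : (2 * rPlus * rMinus : ℂ) ≠ 0 := by
      have h1 : (rPlus : ℂ) ≠ 0 := ofReal_ne_zero.2 rPlus_pos.ne'
      have h2 : (rMinus : ℂ) ≠ 0 := ofReal_ne_zero.2 rMinus_pos.ne'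
      exact mul_ne_zero (mul_ne_zero two_ne_zero h1) h2
    apply mul_left_cancel₀ hpos
    linear_combination e1 - e2
  have hww := mul_conj_of_norm_eq_one hw
  have hWW : W * conj W = 1 := mul_conj_cis _
  have huu := mul_conj_of_norm_eq_one hu
  have hUU : U * conj U = 1 := mul_conj_cis _
  -- Since $|w|=1$, $u^4=(uw)^2(u\bar w)^2$, and both factors are already known.
  have hfour : u ^ 4 = U ^ 4 := by
    have e1 : u ^ 4 = (u * w) ^ 2 * (u * conj w) ^ 2 := by
      linear_combination -u ^ 4 * (w * conj w + 1) * hww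
    have e2 : U ^ 4 = (U * W) ^ 2 * (U * conj W) ^ 2 := by
      linear_combination -U ^ 4 * (W * conj W + 1) * hWW
    rw [e1, e2, hprod, hratio]
  have hUne : U ≠ 0 := cis_ne_zero _
  obtain ⟨n, hn, hun⟩ := exists_I_pow_of_pow_four (z := u / U) (by
    rw [div_pow, hfour, div_self (pow_ne_zero _ hUne)])
  rw [div_eq_iff hUne] at hun
  refine ⟨j, k, m, n, Nat.mod_lt _ (by norm_num), hk, hm, hn, ?_, hvk, ?_⟩
  · rw [cis_thetaPlus_add, hun]
  · rw [cis_thetaMinus_add]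
    have hc := congrArg conj hratio
    simp only [map_mul, conj_conj] at hc
    calc w = u * (conj u * w) := by linear_combination -w * huu
      _ = I ^ n * W := by
        rw [hc, hun]
        linear_combination I ^ n * W * hUU

lemma exists_polar {x z : ℂ} {r : ℝ} (hr : 0 < r) (hx : normSq x = r ^ 2) (hz : ‖z‖ = 1) :
    ∃ u : ℂ, ‖u‖ = 1 ∧ conj z * x = r * u := by
  have hr' : (r : ℂ) ≠ 0 := ofReal_ne_zero.2 hr.ne'
  have hn : ‖x‖ = r := by
    rw [Complex.normSq_eq_norm_sq] at hx
    exact (sq_eq_sq₀ (norm_nonneg _) hr.le).1 hx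
  refine ⟨conj z * x / r, ?_, (mul_div_cancel₀ _ hr').symm⟩
  rw [norm_div, norm_mul, RCLike.norm_conj, hz, hn, one_mul, Complex.norm_real, Real.norm_eq_abs,
    abs_of_pos hr, div_self hr.ne']

lemma Sol.exists_polar {x₀ x₁ x₂ x₃ : ℂ} (h : Sol x₀ x₁ x₂ x₃) (hre : (x₀ * conj x₂).re = 0)
    (h₀ : normSq x₀ = r0 ^ 2) (h₁ : normSq x₁ = rPlus ^ 2) (h₂ : normSq x₂ = r1 ^ 2)
    (h₃ : normSq x₃ = rMinus ^ 2) :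
    ∃ z : ℂ, ‖z‖ = 1 ∧ ∃ j k m n : ℕ, j < 2 ∧ k < 2 ∧ m < 2 ∧ n < 4 ∧ x₀ = z * r0 ∧
      x₁ = z * polar rPlus (thetaPlus j m n) ∧ x₂ = z * polar r1 (theta1 k) ∧
      x₃ = z * polar rMinus (thetaMinus j k m n) := by
  -- The global phase is that of $x_0$; the other entries are then taken relative to it.
  obtain ⟨z, hz, hz0⟩ := DimFour.exists_polar (z := 1) r0_pos h₀ norm_one
  rw [map_one, one_mul] at hz0
  obtain ⟨u, hu, hu1⟩ := DimFour.exists_polar rPlus_pos h₁ hz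
  obtain ⟨v, hv, hv1⟩ := DimFour.exists_polar r1_pos h₂ hz
  obtain ⟨w, hw, hw1⟩ := DimFour.exists_polar rMinus_pos h₃ hz
  have hzz := mul_conj_of_norm_eq_one hz
  have h' := h.smul (z := conj z) (by rw [RCLike.norm_conj, hz])
  have e0 : conj z * x₀ = r0 := by
    rw [hz0]
    linear_combination r0 * hzz
  rw [e0, hu1, hv1, hw1] at h'
  have hvre : v.re = 0 := by
    have e : x₀ * conj x₂ = ((r0 * r1 : ℝ) : ℂ) * conj v := by
      calc x₀ * conj x₂ = (conj z * x₀) * conj (conj z * x₂) := by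
            simp only [map_mul, conj_conj]
            linear_combination -(x₀ * conj x₂) * hzz
        _ = _ := by
            rw [e0, hv1, map_mul, conj_ofReal]
            push_cast
            ring
    rw [e, re_ofReal_mul, conj_re] at hre
    exact (mul_eq_zero.1 hre).resolve_left (mul_pos r0_pos r1_pos).ne'
  obtain ⟨j, k, m, n, hj, hk, hm, hn, rfl, rfl, rfl⟩ :=
    ((sol_iff_phaseEq hu hv hw hvre).1 h').exists_cis hu hv hw
  refine ⟨z, hz, j, k, m, n, hj, hk, hm, hn, ?_, ?_, ?_, ?_⟩
  · rw [hz0]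
    ring
  · rw [polar_eq, ← hu1]
    linear_combination -x₁ * hzz
  · rw [polar_eq, ← hv1]
    linear_combination -x₂ * hzz
  · rw [polar_eq, ← hw1]
    linear_combination -x₃ * hzz

/-! ### Classification of the fiducial vectors -/

/-- The explicit vectors, `f` telling which of the two forms is meant. -/
noncomputable def vec (f : Bool) (j k m n : ℕ) : EuclideanSpace ℂ (Fin 4) :=
  if f then !₂[(r0 : ℂ), polar rPlus (thetaPlus j m n), polar r1 (theta1 k),
    polar rMinus (thetaMinus j k m n)]
  else !₂[(r0 : ℂ), polar rMinus (thetaMinus j k m n), polar r1 (theta1 k),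
    polar rPlus (thetaPlus j m n)]

lemma mem_fiducialVectors_iff (v : EuclideanSpace ℂ (Fin 4)) :
    v ∈ fiducialVectors ↔ ∃ f : Bool, ∃ j k m n : ℕ, j < 2 ∧ k < 2 ∧ m < 2 ∧ n < 4 ∧
      ∃ c : Fin 4, v = cycle c (vec f j k m n) := by
  constructor
  · rintro ⟨θp, θ1, θm, ⟨j, k, m, n, hj, hk, hm, hn, hθ⟩, c, hv⟩
    obtain ⟨h1, h2⟩ := Prod.mk.inj hθ
    obtain ⟨h2, h3⟩ := Prod.mk.inj h2
    subst h1 h2 h3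
    rcases hv with hv | hv
    · exact ⟨true, j, k, m, n, hj, hk, hm, hn, c, hv⟩
    · exact ⟨false, j, k, m, n, hj, hk, hm, hn, c, hv⟩
  · rintro ⟨f, j, k, m, n, hj, hk, hm, hn, c, rfl⟩
    refine ⟨thetaPlus j m n, theta1 k, thetaMinus j k m n,
      ⟨j, k, m, n, hj, hk, hm, hn, rfl⟩, c, ?_⟩
    cases f
    · exact Or.inr rfl
    · exact Or.inl rfl

lemma sol_vec (f : Bool) (j k m n : ℕ) (hm : m < 2) :
    Sol (vec f j k m n 0) (vec f j k m n 1) (vec f j k m n 2) (vec f j k m n 3) := by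
  have h := (sol_iff_phaseEq (norm_cis (thetaPlus j m n)) (norm_cis (theta1 k))
    (norm_cis (thetaMinus j k m n)) (phaseEq_cis j k m n hm).re_eq).2 (phaseEq_cis j k m n hm)
  cases f
  · exact h.swap
  · exact h

lemma sol_cycle {v : EuclideanSpace ℂ (Fin 4)} (h : Sol (v 0) (v 1) (v 2) (v 3)) (c : Fin 4) :
    Sol (cycle c v 0) (cycle c v 1) (cycle c v 2) (cycle c v 3) := by
  revert c
  rw [forall_fin_four]
  exact ⟨h, h.rotate, h.rotate.rotate, h.rotate.rotate.rotate⟩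

lemma cycle_neg_cycle (c : Fin 4) (v : EuclideanSpace ℂ (Fin 4)) : cycle (-c) (cycle c v) = v := by
  ext i
  simp [cycle]

lemma cycle_smul (c : Fin 4) (z : ℂ) (v : EuclideanSpace ℂ (Fin 4)) :
    cycle c (z • v) = z • cycle c v := rfl

/-- A shift by one exchanges the pairs $(x_0,x_2)$ and $(x_1,x_3)$ up to order; a shift by two
reverses each pair. -/
lemma exists_cycle_normalized {v : EuclideanSpace ℂ (Fin 4)} (h : Sol (v 0) (v 1) (v 2) (v 3)) :
    ∃ c, (cycle c v 0 * conj (cycle c v 2 : ℂ)).re = 0 ∧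
      normSq (cycle c v 2) ≤ normSq (cycle c v 0) := by
  have hswap : ∀ x y : ℂ, (x * conj y).re = 0 → (y * conj x).re = 0 := by
    intro x y hxy
    simp only [mul_re, conj_re, conj_im] at hxy ⊢
    linarith
  rcases mul_eq_zero.1 h.re_mul with h0 | h0
  · rcases le_total (normSq (v 2)) (normSq (v 0)) with hle | hle
    · exact ⟨0, h0, hle⟩
    · exact ⟨2, hswap _ _ h0, hle⟩
  · rcases le_total (normSq (v 3)) (normSq (v 1)) with hle | hle
    · exact ⟨1, h0, hle⟩
    · exact ⟨3, hswap _ _ h0, hle⟩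

theorem isFiducial_iff_mem_fiducialVectors (φ : EuclideanSpace ℂ (Fin 4)) :
    IsFiducial 4 φ ↔ ∃ v ∈ fiducialVectors, ∃ z : ℂ, ‖z‖ = 1 ∧ φ = z • v := by
  rw [isFiducial_iff_sol]
  constructor
  · intro h
    obtain ⟨c, hre, hle⟩ := exists_cycle_normalized h
    have hc := sol_cycle h c
    suffices ∃ z : ℂ, ‖z‖ = 1 ∧ ∃ f : Bool, ∃ j k m n : ℕ, j < 2 ∧ k < 2 ∧ m < 2 ∧ n < 4 ∧
        cycle c φ = z • vec f j k m n by
      obtain ⟨z, hz, f, j, k, m, n, hj, hk, hm, hn, e⟩ := this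
      refine ⟨_, (mem_fiducialVectors_iff _).2 ⟨f, j, k, m, n, hj, hk, hm, hn, -c, rfl⟩, z, hz, ?_⟩
      rw [← cycle_smul, ← e, cycle_neg_cycle]
    obtain ⟨n0, n2, ⟨n1, n3⟩ | ⟨n1, n3⟩⟩ := hc.moduli hre hle
    · obtain ⟨z, hz, j, k, m, n, hj, hk, hm, hn, e0, e1, e2, e3⟩ := hc.exists_polar hre n0 n1 n2 n3
      refine ⟨z, hz, true, j, k, m, n, hj, hk, hm, hn, ?_⟩
      ext i
      revert i
      rw [forall_fin_four]
      exact ⟨e0, e1, e2, e3⟩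
    · obtain ⟨z, hz, j, k, m, n, hj, hk, hm, hn, e0, e1, e2, e3⟩ :=
        hc.swap.exists_polar hre n0 n3 n2 n1
      refine ⟨z, hz, false, j, k, m, n, hj, hk, hm, hn, ?_⟩
      ext i
      revert i
      rw [forall_fin_four]
      exact ⟨e0, e3, e2, e1⟩
  · rintro ⟨v, hv, z, hz, rfl⟩
    obtain ⟨f, j, k, m, n, -, -, hm, -, c, rfl⟩ := (mem_fiducialVectors_iff v).1 hv
    exact (sol_cycle (sol_vec f j k m n hm) c).smul hz

/-! ### SIC-POVMs as sets of projectors and their labels -/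

/-- The POVM element of a vector. -/
noncomputable def proj (x : EuclideanSpace ℂ (Fin 4)) : Matrix (Fin 4) (Fin 4) ℂ :=
  (1 / ((4 : ℕ) : ℂ)) • Matrix.vecMulVec x.ofLp (star x.ofLp)

lemma proj_apply (x : EuclideanSpace ℂ (Fin 4)) (i j : Fin 4) :
    proj x i j = 1 / 4 * (x i * conj (x j : ℂ)) := by
  simp [proj, Matrix.vecMulVec_apply]

lemma proj_smul {z : ℂ} (hz : ‖z‖ = 1) (x : EuclideanSpace ℂ (Fin 4)) :
    proj (z • x) = proj x := by
  ext i j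
  rw [proj_apply, proj_apply, PiLp.smul_apply, PiLp.smul_apply, smul_eq_mul, smul_eq_mul, map_mul]
  linear_combination 1 / 4 * (x i * conj (x j : ℂ)) * mul_conj_of_norm_eq_one hz

lemma povmElements_displacementOrbit (φ : EuclideanSpace ℂ (Fin 4)) :
    povmElements 4 (displacementOrbit 4 φ) =
      Set.range fun p : Fin 4 × Fin 4 => proj (weyl p.1 p.2 φ) := by
  ext E
  constructor
  · rintro ⟨_, ⟨j, -, k, -, rfl⟩, rfl⟩
    obtain ⟨z, hz, e⟩ := exists_phase_displacement j k φ
    refine ⟨(Fin.ofNat 4 j, Fin.ofNat 4 k), ?_⟩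
    change _ = proj _
    rw [e, proj_smul hz]
  · rintro ⟨⟨j, k⟩, rfl⟩
    obtain ⟨m, hm, rfl⟩ := exists_lift j
    obtain ⟨n, hn, rfl⟩ := exists_lift k
    refine ⟨_, ⟨m, Finset.mem_Icc.1 hm, n, Finset.mem_Icc.1 hn, rfl⟩, ?_⟩
    obtain ⟨z, hz, e⟩ := exists_phase_displacement m n φ
    change _ = proj _
    rw [e, proj_smul hz]

lemma povmElements_smul {z : ℂ} (hz : ‖z‖ = 1) (φ : EuclideanSpace ℂ (Fin 4)) :
    povmElements 4 (displacementOrbit 4 (z • φ)) = povmElements 4 (displacementOrbit 4 φ) := by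
  simp only [povmElements_displacementOrbit, weyl_smul, proj_smul hz]

lemma povmElements_weyl (j k : Fin 4) (φ : EuclideanSpace ℂ (Fin 4)) :
    povmElements 4 (displacementOrbit 4 (weyl j k φ)) =
      povmElements 4 (displacementOrbit 4 φ) := by
  have h : (fun p : Fin 4 × Fin 4 => proj (weyl p.1 p.2 (weyl j k φ))) =
      (fun p : Fin 4 × Fin 4 => proj (weyl p.1 p.2 φ)) ∘ Equiv.addRight (j, k) := by
    funext p
    rw [weyl_comp, proj_smul (norm_I_pow _)]
    rfl
  rw [povmElements_displacementOrbit, povmElements_displacementOrbit, h,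
    (Equiv.addRight (j, k)).surjective.range_comp]

lemma cycle_eq_weyl (c : Fin 4) (v : EuclideanSpace ℂ (Fin 4)) : cycle c v = weyl 0 (-c) v := by
  ext i
  simp [cycle, weyl]

lemma cis_thetaMinus_sign (j k m : ℕ) :
    cis (thetaMinus j k m 0) = (-1) ^ k * cis (thetaMinus j 0 m 0) := by
  rw [← cis_nat_mul_pi, ← cis_add, thetaMinus, thetaMinus]
  congr 1
  push_cast
  ring

/-- The vectors that differ in `n` only lie in the same orbits. -/
lemma exists_vec_eq_weyl (f : Bool) (j k m n : ℕ) :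
    ∃ J : Fin 4, vec f j k m n = weyl J 0 (vec f j ((k + n) % 2) m 0) := by
  -- The index $n$ multiplies the $r_\pm$ entries by $i^n$ and fixes the $r_1$ entry. The diagonal
  -- displacement multiplies the $r_+,r_1,r_-$ entries by $i^n,(-1)^n,i^{3n}$; the excess $(-1)^n$
  -- on the last two is a change of $k$. In the second form $r_+$ stands in place $3$, hence the
  -- index $3n$.
  have hm : (-1 : ℂ) ^ ((k + n) % 2) = (-1) ^ k * (-1) ^ n := by
    rw [← pow_add]
    exact neg_one_pow_congr (by omega)
  have hI : ∀ l : ℕ, I ^ (2 * l) = (-1) ^ l := fun l => by rw [pow_mul, I_sq]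
  have hnn : (-1 : ℂ) ^ n * (-1) ^ n = 1 := by
    rw [← mul_pow]
    simp
  cases f
  · refine ⟨Fin.ofNat 4 (3 * n), ?_⟩
    ext i
    revert i
    rw [forall_fin_four]
    refine ⟨?_, ?_, ?_, ?_⟩
    · change (r0 : ℂ) = I ^ (_ * 0) * (r0 : ℂ)
      simp
    · change polar rMinus _ = I ^ (3 * n % 4 * 1) * polar rMinus _
      rw [polar_eq, polar_eq, cis_thetaMinus_add, cis_thetaMinus_sign j k,
        cis_thetaMinus_sign j ((k + n) % 2), hm,
        I_pow_congr (m := 3 * n % 4 * 1) (n := 2 * n + n) (by omega), pow_add, hI]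
      linear_combination -(rMinus * (I ^ n * ((-1) ^ k * cis (thetaMinus j 0 m 0)))) * hnn
    · change polar r1 _ = I ^ (3 * n % 4 * 2) * polar r1 _
      rw [polar_eq, polar_eq, cis_theta1, cis_theta1, hm,
        I_pow_congr (m := 3 * n % 4 * 2) (n := 2 * n) (by omega), hI]
      linear_combination -(r1 * ((-1) ^ k * I)) * hnn
    · change polar rPlus _ = I ^ (3 * n % 4 * 3) * polar rPlus _
      rw [polar_eq, polar_eq, cis_thetaPlus_add, I_pow_congr (m := 3 * n % 4 * 3) (n := n) (by omega)]
      ring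
  · refine ⟨Fin.ofNat 4 n, ?_⟩
    ext i
    revert i
    rw [forall_fin_four]
    refine ⟨?_, ?_, ?_, ?_⟩
    · change (r0 : ℂ) = I ^ (_ * 0) * (r0 : ℂ)
      simp
    · change polar rPlus _ = I ^ (n % 4 * 1) * polar rPlus _
      rw [polar_eq, polar_eq, cis_thetaPlus_add, I_pow_congr (m := n % 4 * 1) (n := n) (by omega)]
      ring
    · change polar r1 _ = I ^ (n % 4 * 2) * polar r1 _
      rw [polar_eq, polar_eq, cis_theta1, cis_theta1, hm,
        I_pow_congr (m := n % 4 * 2) (n := 2 * n) (by omega), hI]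
      linear_combination -(r1 * ((-1) ^ k * I)) * hnn
    · change polar rMinus _ = I ^ (n % 4 * 3) * polar rMinus _
      rw [polar_eq, polar_eq, cis_thetaMinus_add, cis_thetaMinus_sign j k,
        cis_thetaMinus_sign j ((k + n) % 2), hm,
        I_pow_congr (m := n % 4 * 3) (n := 2 * n + n) (by omega), pow_add, hI]
      linear_combination -(rMinus * (I ^ n * ((-1) ^ k * cis (thetaMinus j 0 m 0)))) * hnn

/-- The SIC-POVMs, labelled by the form of a fiducial vector and the signs in its phases. -/
noncomputable def sic (p : Bool × Fin 2 × Fin 2 × Fin 2) : Set (Matrix (Fin 4) (Fin 4) ℂ) :=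
  povmElements 4 (displacementOrbit 4 (vec p.1 p.2.1 p.2.2.1 p.2.2.2 0))

lemma covariantSICPOVMs_eq_range : covariantSICPOVMs 4 = Set.range sic := by
  ext S
  constructor
  · rintro ⟨φ, hφ, rfl⟩
    obtain ⟨v, hv, z, hz, rfl⟩ := (isFiducial_iff_mem_fiducialVectors φ).1 hφ
    obtain ⟨f, j, k, m, n, hj, hk, hm, hn, c, rfl⟩ := (mem_fiducialVectors_iff v).1 hv
    obtain ⟨J, hJ⟩ := exists_vec_eq_weyl f j k m n
    refine ⟨(f, ⟨j, hj⟩, ⟨(k + n) % 2, Nat.mod_lt _ (by norm_num)⟩, ⟨m, hm⟩), ?_⟩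
    rw [povmElements_smul hz, cycle_eq_weyl, povmElements_weyl, hJ, povmElements_weyl]
    rfl
  · rintro ⟨⟨f, j, k, m⟩, rfl⟩
    exact ⟨vec f j k m 0, (isFiducial_iff_sol _).2 (sol_vec f j k m 0 m.2), rfl⟩

/-! ### Distinctness of the sixteen SIC-POVMs -/

lemma rMinus_sq_lt : rMinus ^ 2 < 1 / 5 := by
  rw [rMinus_sq]
  have h1 := sqrt_five_lt
  have h2 := lt_sqrt_five
  have h3 := kappa_sq
  nlinarith [kappa_pos]

lemma lt_r0_sq : 1 / 5 < r0 ^ 2 := by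
  rw [r0_sq]
  nlinarith [sqrt_five_lt, one_lt_sqrt_two]

lemma r1_sq_lt : r1 ^ 2 < r0 ^ 2 := by
  rw [r0_sq, r1_sq]
  nlinarith [sqrt_five_lt, sqrt_two_pos]

lemma r0_sq_lt_rPlus_sq : r0 ^ 2 < rPlus ^ 2 := by
  rw [r0_sq, rPlus_sq]
  have h2 := lt_sqrt_five
  nlinarith [kappa_pos, sqrt_two_lt, sqrt_five_lt]

lemma normSq_polar (r θ : ℝ) : normSq (polar r θ) = r ^ 2 := by
  rw [polar_eq, normSq_mul, normSq_ofReal, Complex.normSq_eq_norm_sq, norm_cis]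
  ring

/-- The imaginary part of the square is $\pm2\sin a\cos a\neq0$, with sign $(-1)^m$. -/
lemma cis_signed_sq_inj {m m' : ℕ} (hm : m < 2) (hm' : m' < 2)
    (h : cis ((-1) ^ m * a) ^ 2 = cis ((-1) ^ m' * a) ^ 2) : m = m' := by
  have hpos := mul_pos cos_a_pos sin_a_pos
  have := congrArg im h
  simp only [pow_two (cis _), mul_im, cis_re, cis_im] at this
  interval_cases m <;> interval_cases m'
  · rfl
  · simp at this
    linarith
  · simp at this
    linarith
  · rfl

lemma neg_one_pow_inj {j j' : ℕ} (hj : j < 2) (hj' : j' < 2) (h : (-1 : ℂ) ^ j = (-1) ^ j') :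
    j = j' := by
  interval_cases j <;> interval_cases j'
  · rfl
  · norm_num at h
  · norm_num at h
  · rfl

lemma cis_thetaPlus_pow_four (j m : ℕ) :
    cis (thetaPlus j m 0) ^ 4 =
      (-1) ^ j * ((-1) ^ (m + 1) * (cis ((-1) ^ m * b) * cis ((-1) ^ m * a) ^ 2)) := by
  -- $\theta_+$ does not involve $k$; the choice $k=j$ removes the sign $(-1)^{j+k}$.
  have h1 := cis_thetaPlus_mul_conj j j m 0
  have h2 := cis_thetaPlus_mul_thetaMinus_sq j j m 0
  have h3 := mul_conj_cis (thetaMinus j j m 0)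
  rw [show m + j + 1 = j + (m + 1) by ring, pow_add] at h2
  have h4 : (-1 : ℂ) ^ (j + j) = 1 := by rw [← two_mul, pow_mul]; simp
  rw [h4, one_mul] at h1
  rw [← h1]
  calc _ = (cis (thetaPlus j m 0) * cis (thetaMinus j j m 0)) ^ 2 *
        (cis (thetaPlus j m 0) * conj (cis (thetaMinus j j m 0))) ^ 2 := by
        linear_combination -cis (thetaPlus j m 0) ^ 4 *
          (cis (thetaMinus j j m 0) * conj (cis (thetaMinus j j m 0)) + 1) * h3
    _ = _ := by
        rw [h2]
        ring

/-- As $p^4=1$, a diagonal displacement preserves $(u\bar w)^2$, which determines $m$, and $u^4$,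
which then determines $j$. Equal $u$ forces $p=1$, and $v$ gives $k$. -/
lemma phases_inj {j k m j' k' m' : ℕ} (hj : j < 2) (hk : k < 2) (hm : m < 2) (hj' : j' < 2)
    (hk' : k' < 2) (hm' : m' < 2) {p : ℂ} (hp : ‖p‖ = 1) (hp4 : p ^ 4 = 1)
    (h₁ : cis (thetaPlus j m 0) = p * cis (thetaPlus j' m' 0))
    (h₂ : cis (theta1 k) = p ^ 2 * cis (theta1 k'))
    (h₃ : cis (thetaMinus j k m 0) = p ^ 3 * cis (thetaMinus j' k' m' 0)) :
    j = j' ∧ k = k' ∧ m = m' := by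
  have hpp := mul_conj_of_norm_eq_one hp
  have hsq : ∀ i : ℕ, ((-1 : ℂ) ^ i) ^ 2 = 1 := fun i => by rw [← pow_mul, mul_comm, pow_mul]; simp
  have hmm : m = m' := by
    apply cis_signed_sq_inj hm hm'
    have e := cis_thetaPlus_mul_conj j k m 0
    have e' := cis_thetaPlus_mul_conj j' k' m' 0
    have e2 := congrArg (· ^ 2) e
    have e2' := congrArg (· ^ 2) e'
    simp only [mul_pow, hsq, one_mul] at e2 e2'
    have hc : conj p = p ^ 3 := by
      linear_combination -conj p * hp4 + p ^ 3 * hpp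
    rw [← e2, ← e2', h₁, h₃, map_mul, map_pow, hc]
    linear_combination (cis (thetaPlus j' m' 0) ^ 2 * conj (cis (thetaMinus j' k' m' 0)) ^ 2) *
      (p ^ 16 + p ^ 12 + p ^ 8 + p ^ 4 + 1) * hp4
  subst hmm
  have hjj : j = j' := by
    apply neg_one_pow_inj hj hj'
    have e : cis (thetaPlus j m 0) ^ 4 = cis (thetaPlus j' m 0) ^ 4 := by
      rw [h₁, mul_pow, hp4, one_mul]
    rw [cis_thetaPlus_pow_four, cis_thetaPlus_pow_four] at e
    refine mul_right_cancel₀ ?_ e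
    exact mul_ne_zero (pow_ne_zero _ (by norm_num))
      (mul_ne_zero (cis_ne_zero _) (pow_ne_zero _ (cis_ne_zero _)))
  subst hjj
  have hp1 : p = 1 := by
    apply mul_right_cancel₀ (cis_ne_zero (thetaPlus j m 0))
    rw [← h₁, one_mul]
  refine ⟨rfl, ?_, rfl⟩
  rw [hp1, one_pow, one_mul, cis_theta1, cis_theta1] at h₂
  exact neg_one_pow_inj hk hk' (mul_right_cancel₀ I_ne_zero h₂)

lemma vec_zero (f : Bool) (j k m n : ℕ) : vec f j k m n 0 = r0 := by
  cases f <;> rfl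

lemma normSq_vec_ne (f : Bool) (j k m n : ℕ) (i : Fin 4) (hi : i ≠ 0) :
    normSq (vec f j k m n i) ≠ r0 ^ 2 := by
  have h1 := rMinus_sq_lt.trans lt_r0_sq
  have h2 := r1_sq_lt
  have h3 := r0_sq_lt_rPlus_sq
  revert i
  rw [forall_fin_four]
  refine ⟨fun h => absurd rfl h, fun _ => ?_, fun _ => ?_, fun _ => ?_⟩ <;> cases f
  · change normSq (polar rMinus _) ≠ _
    rw [normSq_polar]
    exact h1.ne
  · change normSq (polar rPlus _) ≠ _
    rw [normSq_polar]
    exact h3.ne'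
  · change normSq (polar r1 _) ≠ _
    rw [normSq_polar]
    exact h2.ne
  · change normSq (polar r1 _) ≠ _
    rw [normSq_polar]
    exact h2.ne
  · change normSq (polar rPlus _) ≠ _
    rw [normSq_polar]
    exact h3.ne'
  · change normSq (polar rMinus _) ≠ _
    rw [normSq_polar]
    exact h1.ne

lemma polar_eq_mul_polar {r : ℝ} (hr : 0 < r) {θ θ' : ℝ} {z : ℂ}
    (h : polar r θ = z * polar r θ') : cis θ = z * cis θ' := by
  rw [polar_eq, polar_eq] at h
  apply mul_left_cancel₀ (ofReal_ne_zero.2 hr.ne' : (r : ℂ) ≠ 0)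
  linear_combination h

lemma sic_injective : Function.Injective sic := by
  rintro ⟨f, j, k, m⟩ ⟨f', j', k', m'⟩ h
  have hmem : proj (vec f j k m 0) ∈ sic (f', j', k', m') := by
    rw [← h, sic, povmElements_displacementOrbit]
    exact ⟨(0, 0), by simp only [weyl_zero]⟩
  rw [sic, povmElements_displacementOrbit] at hmem
  obtain ⟨⟨J, K⟩, hJK⟩ := hmem
  dsimp only at hJK
  set v := vec f j k m 0 with hv
  set v' := vec f' j' k' m' 0 with hv'
  have hent : ∀ i l : Fin 4, (weyl J K v') i * conj (weyl J K v' l : ℂ) = v i * conj (v l : ℂ) := by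
    intro i l
    have e := congrFun (congrFun hJK i) l
    rw [proj_apply, proj_apply] at e
    linear_combination 4 * e
  have hns : ∀ i, normSq (v' (i - K)) = normSq (v i) := by
    intro i
    have e := hent i i
    rw [Complex.mul_conj, Complex.mul_conj] at e
    rw [← ofReal_inj.1 e]
    change _ = normSq (I ^ _ * v' (i - K))
    rw [normSq_mul, Complex.normSq_eq_norm_sq (I ^ _), norm_I_pow]
    ring
  -- Only entry $0$ has modulus $r_0$, so no nontrivial shift is possible.
  have hK : K = 0 := by
    by_contra hK
    have e := hns 0
    rw [hv, vec_zero, normSq_ofReal, ← pow_two, zero_sub] at e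
    exact normSq_vec_ne _ _ _ _ _ _ (neg_ne_zero.2 hK) e
  subst hK
  simp only [sub_zero] at hns
  have hr0 : (r0 : ℂ) ≠ 0 := ofReal_ne_zero.2 r0_pos.ne'
  -- Equal projectors determine vectors up to a phase, and that phase is $1$ because both entries in
  -- place $0$ are $r_0>0$.
  have hval : ∀ i : Fin 4, v i = I ^ ((J : ℕ) * (i : ℕ)) * v' i := by
    intro i
    have e := hent i 0
    have e0 : weyl J 0 v' 0 = r0 := by
      change I ^ ((J : ℕ) * 0) * v' (0 - 0) = r0
      rw [sub_zero, hv', vec_zero, mul_zero, pow_zero, one_mul]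
    rw [e0, hv, vec_zero, conj_ofReal] at e
    rw [hv, ← mul_right_cancel₀ hr0 e]
    change I ^ _ * v' (i - 0) = _
    rw [sub_zero]
  have hne : rMinus ^ 2 ≠ rPlus ^ 2 :=
    ((rMinus_sq_lt.trans lt_r0_sq).trans r0_sq_lt_rPlus_sq).ne
  have hJ4 : ∀ l : ℕ, (I ^ l) ^ 4 = 1 := fun l => by
    rw [← pow_mul, mul_comm, pow_mul, I_pow_four, one_pow]
  have h1 := hns 1
  have g1 := hval 1
  have g2 := hval 2
  have g3 := hval 3
  suffices f = f' ∧ (j : ℕ) = j' ∧ (k : ℕ) = k' ∧ (m : ℕ) = m' by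
    obtain ⟨rfl, e1, e2, e3⟩ := this
    rw [Fin.ext e1, Fin.ext e2, Fin.ext e3]
  cases f <;> cases f'
  -- With $r_+$ in place $3$ one takes $p=i^{3J}$, so that $p^2=i^{2J}$ and $p^3=i^{J}$.
  · refine ⟨rfl, phases_inj j.2 k.2 m.2 j'.2 k'.2 m'.2 (norm_I_pow ((J : ℕ) * 3)) (hJ4 _)
      (polar_eq_mul_polar rPlus_pos g3) ?_ ?_⟩
    · rw [← pow_mul, I_pow_congr (n := (J : ℕ) * 2) (by omega)]
      exact polar_eq_mul_polar r1_pos g2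
    · rw [← pow_mul, I_pow_congr (n := (J : ℕ) * 1) (by omega)]
      exact polar_eq_mul_polar rMinus_pos g1
  · change normSq (polar rPlus _) = normSq (polar rMinus _) at h1
    rw [normSq_polar, normSq_polar] at h1
    exact absurd h1.symm hne
  · change normSq (polar rMinus _) = normSq (polar rPlus _) at h1
    rw [normSq_polar, normSq_polar] at h1
    exact absurd h1 hne
  · refine ⟨rfl, phases_inj j.2 k.2 m.2 j'.2 k'.2 m'.2 (norm_I_pow ((J : ℕ) * 1)) (hJ4 _)
      (polar_eq_mul_polar rPlus_pos g1) ?_ ?_⟩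
    · rw [← pow_mul, I_pow_congr (n := (J : ℕ) * 2) (by omega)]
      exact polar_eq_mul_polar r1_pos g2
    · rw [← pow_mul, I_pow_congr (n := (J : ℕ) * 3) (by omega)]
      exact polar_eq_mul_polar rMinus_pos g3

theorem ncard_covariantSICPOVMs : (covariantSICPOVMs 4).ncard = 16 := by
  rw [covariantSICPOVMs_eq_range, ← Set.image_univ, Set.ncard_image_of_injective _ sic_injective,
    Set.ncard_univ, Nat.card_eq_fintype_card]
  rfl

end DimFour


theorem mainTheorem2 :
    (∀ φ : EuclideanSpace ℂ (Fin 4),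
      IsFiducial 4 φ ↔ ∃ v ∈ DimFour.fiducialVectors, ∃ z : ℂ, ‖z‖ = 1 ∧ φ = z • v) ∧
    (covariantSICPOVMs 4).ncard = 16 :=
  ⟨DimFour.isFiducial_iff_mem_fiducialVectors, DimFour.ncard_covariantSICPOVMs⟩
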